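/- Notation. For $N\in\mathbb{N}$ let $\mathcal{S}:\mathbb{C}^{N\times N}\to\mathbb{C}^{N\times N}$ be a linear operator that preserves positivity, i.e. $\mathcal{S}(R)\ge 0$ whenever $R\ge 0$ (for example the self-energy operator $\mathcal{S}(R)=\mathbb{E}[HRH]$ of a Hermitian random matrix $H$). Its coefficients $\mathcal{S}_{xy,zt}$ are defined by $\mathcal{S}(R)_{xt}=\sum_{y,z=1}^N \mathcal{S}_{xy,zt}R_{yz}$. For $l>0$ put $$\|\mathcal{S}\|_l=\max_{x,y,z,t}e^{\rho(xy,zt)/l}|\mathcal{S}_{xy,zt}|,\quad \rho(xy,zt)=\min\{|x-t|+|y-z|,\,|x-z|+|y-t|\},\qquad \|A\|_l=\max_{a,b}e^{|a-b|/l}|A_{ab}|$$ for $A\in\mathbb{C}^{N\times N}$. The Matrix Dyson Equation (MDE) at $z\in\mathbb{C}$ is $-M^{-1}=z+\mathcal{S}(M)$ for an invertible $M\in\mathbb{C}^{N\times N}$. Let $\mathcal{T}_k$ be the set of ordered (plane) rooted trees with $k$ edges. For $\Gamma\in\mathcal{T}_k$ let $c(v)$ be the number of children of the vertex $v$; for an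 edge $e$ let $e_-$ be its end closer to the root and $e_+$ the other end, and let $e_+$ be the $n(e_+)$-th child of $e_-$. A labelling $\mathbf{x}\in\mathcal{X}_{ab}(\Gamma)$ assigns to every vertex $v$ labels $x^v_0,\dots,x^v_{c(v)}\in\{1,\dots,N\}$ such that $x^{root}_0=a$ and $x^{root}_{c(root)}=b$. Define the matrices $\mathrm{val}(\Gamma)$ and $C_k$ and the Laurent series $M(z)$ by $$\mathrm{val}_{ab}(\Gamma)=\sum_{\mathbf{x}\in\mathcal{X}_{ab}(\Gamma)}\ \prod_{e\in E(\Gamma)}\mathcal{S}_{x^{e_-}_{n(e_+)-1}x^{e_+}_0,\;x^{e_+}_{c(e_+)}x^{e_-}_{n(e_+)}},\qquad C_k=\sum_{\Gamma\in\mathcal{T}_k}\mathrm{val}(\Gamma),\qquad M(z)=-\sum_{k=0}^\infty C_kz^{-2k-1}.$$ Theorem. For all $l>0$ and $\varepsilon>0$ there is a constant $K=K(l,\varepsilon)>0$ such that the following holds for all $c\ge 0$, all $N$ and all positivity preserving linear $\mathcal{S}$ on $\mathbb{C}^{N\times N}$ with $\|\mathcal{S}\|_l\le c/N$. Put $R=R(l,\varepsilon)=Kc$.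 1. $\|C_k\|_{(1+\varepsilon)l}\le R^k$ for every $k\ge 0$. 2. For every $z\in\mathbb{C}$ with $|z|^2>R$ the series $M(z)$ converges absolutely in the $(1+\varepsilon)l$-norm, its sum satisfies the MDE at $z$, and, uniformly in $N$, $$\|M(z)\|_{(1+\varepsilon)l}\le |z|^{-1}\bigl(1-R|z|^{-2}\bigr)^{-1},$$ so that $M(z)$ has exponential off-diagonal decay. 3. For every $z\in\mathbb{H}=\{\operatorname{Im}z>0\}$ the MDE has exactly one solution $\widetilde M(z)$ whose imaginary part $\frac{1}{2i}(\widetilde M(z)-\widetilde M(z)^*)$ is positive definite, and $\widetilde M(z)=M(z)$ for all $z\in\mathbb{H}$ with $|z|^2>R$. -/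

import Mathlib

namespace MDE

/-- Finite rooted trees in which the children of every vertex are linearly ordered:
`node n child` has a root with `n` children, the `i`-th one being the root of `child i`. -/
inductive OrderedTree : Type
  | node (n : ℕ) (child : Fin n → OrderedTree) : OrderedTree

namespace OrderedTree

/-- The vertices of an ordered tree: the root, and the vertices of the subtrees. -/
def Vertex : OrderedTree → Type
  | node n child => Option ((i : Fin n) × Vertex (child i))

/-- The root. -/
def root : (Γ : OrderedTree) → Vertex Γ
  | node _ _ => none

/-- The number `c(v)` of children of a vertex `v`. -/
def numChildren : (Γ : OrderedTree) → Vertex Γ → ℕ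
  | node n _, none => n
  | node _ child, some ⟨i, v⟩ => numChildren (child i) v

/-- The `j`-th child of a vertex (counted from `0`). -/
def childOf : (Γ : OrderedTree) → (v : Vertex Γ) → Fin (numChildren Γ v) → Vertex Γ
  | node _ child, none, i => some ⟨i, root (child i)⟩
  | node _ child, some ⟨i, v⟩, j => some ⟨i, childOf (child i) v j⟩

/-- An edge `e` is given by its upper end `e₋` and the position of its lower end `e₊` among the
children of `e₋`. -/
abbrev Edge (Γ : OrderedTree) : Type := (v : Vertex Γ) × Fin (numChildren Γ v)

/-- The vertices `p_0^v, …, p_{c(v)}^v` of the frame of `Γ`: a walk around the tree visits each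
vertex `v` exactly `c(v) + 1` times. -/
abbrev FramePoint (Γ : OrderedTree) : Type := (v : Vertex Γ) × Fin (numChildren Γ v + 1)

/-- A labelling `x` of the frame by elements of `[N]`; the label `x_j^v` is `x ⟨v, j⟩`. -/
abbrev Labelling (Γ : OrderedTree) (N : ℕ) : Type := FramePoint Γ → Fin N

instance instFintypeVertex : (Γ : OrderedTree) → Fintype (Vertex Γ)
  | node n child =>
    haveI : ∀ i, Fintype (Vertex (child i)) := fun i => instFintypeVertex (child i)
    inferInstanceAs (Fintype (Option ((i : Fin n) × Vertex (child i))))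

noncomputable instance instDecidableEqVertex (Γ : OrderedTree) : DecidableEq (Vertex Γ) :=
  Classical.decEq _

/-- The number of edges. -/
def numEdges (Γ : OrderedTree) : ℕ := Fintype.card (Edge Γ)

theorem numEdges_node (n : ℕ) (child : Fin n → OrderedTree) :
    numEdges (node n child) = n + ∑ i, numEdges (child i) := by
  let e : Edge (node n child) ≃ Fin n ⊕ ((i : Fin n) × Edge (child i)) :=
    { toFun := fun x => match x with
        | ⟨none, i⟩ => Sum.inl i
        | ⟨some ⟨i, v⟩, j⟩ => Sum.inr ⟨i, ⟨v, j⟩⟩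
      invFun := fun x => match x with
        | Sum.inl i => ⟨none, i⟩
        | Sum.inr ⟨i, ⟨v, j⟩⟩ => ⟨some ⟨i, v⟩, j⟩
      left_inv := by rintro ⟨_ | ⟨i, v⟩, j⟩ <;> rfl
      right_inv := by rintro (i | ⟨i, ⟨v, j⟩⟩) <;> rfl }
  unfold numEdges
  rw [Fintype.card_congr e, Fintype.card_sum, Fintype.card_sigma, Fintype.card_fin]

theorem finite_numEdges_eq (k : ℕ) : {Γ : OrderedTree | numEdges Γ = k}.Finite := by
  induction k using Nat.strong_induction_on with
  | _ k ih =>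
    have hlt : {Γ : OrderedTree | numEdges Γ < k}.Finite := by
      have : {Γ : OrderedTree | numEdges Γ < k}
          = ⋃ j ∈ Set.Iio k, {Γ : OrderedTree | numEdges Γ = j} := by
        ext Γ; simp
      rw [this]
      exact (Set.finite_Iio k).biUnion fun j hj => ih j hj
    refine ((Set.finite_Iic k).biUnion fun n _ =>
      (Set.Finite.pi' fun _ : Fin n => hlt).image (node n)).subset ?_
    rintro ⟨n, child⟩ h
    have h : n + ∑ i, numEdges (child i) = k := by rw [← numEdges_node]; exact h
    refine Set.mem_biUnion (x := n) (by simp only [Set.mem_Iic]; omega) ⟨child, fun i => ?_, rfl⟩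
    have h1 : numEdges (child i) ≤ ∑ i, numEdges (child i) :=
      Finset.single_le_sum (f := fun i => numEdges (child i)) (fun _ _ => Nat.zero_le _)
        (Finset.mem_univ i)
    have h2 := i.pos
    change numEdges (child i) < k
    omega

/-- The set `𝒯_k` of ordered trees with `k` edges. -/
noncomputable def treesWithEdges (k : ℕ) : Finset OrderedTree := (finite_numEdges_eq k).toFinset

end OrderedTree

open OrderedTree

/-- The coefficients `S_{xy,zt}` of a linear map `S` on `N × N` matrices, which are determined by
`S(R)_{xt} = ∑_{y,z} S_{xy,zt} R_{yz}`. -/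
noncomputable def coeff {N : ℕ}
    (S : Matrix (Fin N) (Fin N) ℂ →ₗ[ℂ] Matrix (Fin N) (Fin N) ℂ) (x y z t : Fin N) : ℂ :=
  S (Matrix.single y z 1) x t

/-- `|x - y|` for indices `x, y ∈ [N]`. -/
noncomputable def idxDist {N : ℕ} (x y : Fin N) : ℝ := |((x : ℕ) : ℝ) - ((y : ℕ) : ℝ)|

/-- `ρ(xy, zt) = min{|x - t| + |y - z|, |x - z| + |y - t|}`. -/
noncomputable def rho {N : ℕ} (x y z t : Fin N) : ℝ :=
  min (idxDist x t + idxDist y z) (idxDist x z + idxDist y t)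

/-- The `l`-norm of a matrix, `max_{a,b} e^{|a-b|/l} |A_{ab}|`. -/
noncomputable def matLNorm {N : ℕ} (l : ℝ) (A : Matrix (Fin N) (Fin N) ℂ) : ℝ :=
  ⨆ p : Fin N × Fin N, Real.exp (idxDist p.1 p.2 / l) * ‖A p.1 p.2‖

/-- The `l`-norm of an operator on matrices, `max_{x,y,z,t} e^{ρ(xy,zt)/l} |S_{xy,zt}|`. -/
noncomputable def opLNorm {N : ℕ} (l : ℝ)
    (S : Matrix (Fin N) (Fin N) ℂ →ₗ[ℂ] Matrix (Fin N) (Fin N) ℂ) : ℝ :=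
  ⨆ p : Fin N × Fin N × Fin N × Fin N,
    Real.exp (rho p.1 p.2.1 p.2.2.1 p.2.2.2 / l) * ‖coeff S p.1 p.2.1 p.2.2.1 p.2.2.2‖

/-- The value `val(Γ)` of an ordered tree: the `(a, b)` entry sums, over the labellings with
`x_0^{root} = a` and `x_{c(root)}^{root} = b`, the product over the edges `e` of
`S_{x_{n(e₊)-1}^{e₋} x_0^{e₊}, x_{c(e₊)}^{e₊} x_{n(e₊)}^{e₋}}`, where `e₊` is the `n(e₊)`-th child
of `e₋`, counted from `1`. -/
noncomputable def val {N : ℕ}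
    (S : Matrix (Fin N) (Fin N) ℂ →ₗ[ℂ] Matrix (Fin N) (Fin N) ℂ) (Γ : OrderedTree) :
    Matrix (Fin N) (Fin N) ℂ :=
  Matrix.of fun a b =>
    ∑ x : Labelling Γ N with x ⟨root Γ, 0⟩ = a ∧ x ⟨root Γ, Fin.last _⟩ = b,
      ∏ e : Edge Γ,
        coeff S (x ⟨e.1, e.2.castSucc⟩) (x ⟨childOf Γ e.1 e.2, 0⟩)
          (x ⟨childOf Γ e.1 e.2, Fin.last _⟩) (x ⟨e.1, e.2.succ⟩)

/-- `C_k = ∑_{Γ ∈ 𝒯_k} val(Γ)`. -/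
noncomputable def treeCoeff {N : ℕ}
    (S : Matrix (Fin N) (Fin N) ℂ →ₗ[ℂ] Matrix (Fin N) (Fin N) ℂ) (k : ℕ) :
    Matrix (Fin N) (Fin N) ℂ :=
  ∑ Γ ∈ treesWithEdges k, val S Γ

/-- The `k`-th term `-C_k z^{-2k-1}` of the Laurent series over ordered trees. -/
noncomputable def seriesTerm {N : ℕ}
    (S : Matrix (Fin N) (Fin N) ℂ →ₗ[ℂ] Matrix (Fin N) (Fin N) ℂ) (z : ℂ) (k : ℕ) :
    Matrix (Fin N) (Fin N) ℂ :=
  -((z ^ (2 * k + 1))⁻¹ • treeCoeff S k)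

/-- The sum `M(z) = -∑_k C_k z^{-2k-1}` of the Laurent series. -/
noncomputable def treeSeries {N : ℕ}
    (S : Matrix (Fin N) (Fin N) ℂ →ₗ[ℂ] Matrix (Fin N) (Fin N) ℂ) (z : ℂ) :
    Matrix (Fin N) (Fin N) ℂ :=
  ∑' k, seriesTerm S z k

/-- `M` solves the Matrix Dyson Equation `-M⁻¹ = z + S(M)` at `z`. -/
def SolvesMDE {N : ℕ}
    (S : Matrix (Fin N) (Fin N) ℂ →ₗ[ℂ] Matrix (Fin N) (Fin N) ℂ) (z : ℂ)
    (M : Matrix (Fin N) (Fin N) ℂ) : Prop :=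
  IsUnit M ∧ -M⁻¹ = z • (1 : Matrix (Fin N) (Fin N) ℂ) + S M

open scoped ComplexOrder in
/-- `Im M = (M - M*) / (2i)` is positive definite. -/
def HasPosIm {N : ℕ} (M : Matrix (Fin N) (Fin N) ℂ) : Prop :=
  ((2 * Complex.I)⁻¹ • (M - M.conjTranspose)).PosDef

open scoped ComplexOrder in
/-- `S` maps positive semidefinite matrices to positive semidefinite matrices, as the self-energy
operator `R ↦ E[H R H]` of every Hermitian random matrix `H` does. -/
def PositivityPreserving {N : ℕ}
    (S : Matrix (Fin N) (Fin N) ℂ →ₗ[ℂ] Matrix (Fin N) (Fin N) ℂ) : Prop :=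
  ∀ R : Matrix (Fin N) (Fin N) ℂ, R.PosSemidef → (S R).PosSemidef

end MDE

/-!
Cutting off the first subtree at the root turns `∑_Γ val(Γ)` into the recursion
`C_{k+1} = ∑_{i+j=k} S(C_i) C_j`, so that `M(z) = -∑_k C_k z^{-2k-1}` solves `(z + S(M)) M = -1`
formally. In a submultiplicative norm with `‖1‖ ≤ 1` and `‖S(A)‖ ≤ κ‖A‖` the recursion gives
`‖C_k‖ ≤ catalan k * κ^k ≤ (4κ)^k`. Such a norm, dominating the `l'`-norm, is the maximum over the
rows of `A` and `Aᴴ` of the `ℓ¹` norm with weight `e^{|a-b|/l'}`; it satisfies the bound with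
`κ = O(N ‖S‖_l)` for `l' > l`, since the gap `1/l - 1/l'` makes all sums over indices geometric.

For `Im z > 0` the map `M ↦ -(z + S(M))⁻¹` sends the matrices with positive definite imaginary part
and norm below `1 + 1 / Im z` strictly inside this set, and the Earle–Hamilton theorem gives exactly
one fixed point. The imaginary part of the series `M` satisfies
`Im M = (Im z) Mᴴ M + Mᴴ S(Im M) M`. For large `|z|` the linear map `X ↦ Mᴴ S(X) M` is a
contraction, so `Im M` is the sum of the Neumann series with first term `(Im z) Mᴴ M` and is
positive definite. Hence `M` is that fixed point.
-/

namespace MDE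

open OrderedTree Finset.HasAntidiagonal

/-- `C` satisfies the quadratic recursion that the coefficients of a solution
`M(z) = -∑_k C_k z^{-2k-1}` of `(z + S M) M = -1` have to satisfy. -/
structure IsDysonRecursion {A : Type*} [Semiring A] (S : A → A) (C : ℕ → A) : Prop where
  zero : C 0 = 1
  succ (k : ℕ) : C (k + 1) = ∑ p ∈ antidiagonal k, S (C p.1) * C p.2

section Trees

theorem sum_paths_eq_prod {ι R : Type*} [Fintype ι] [DecidableEq ι] [CommSemiring R] {n : ℕ}
    (A : Fin n → Matrix ι ι R) (a b : ι) :
    ∑ r : Fin (n + 1) → ι with r 0 = a ∧ r (Fin.last n) = b, ∏ i, A i (r i.castSucc) (r i.succ) =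
      (List.ofFn A).prod a b := by
  induction n generalizing a with
  | zero =>
    rw [Finset.sum_filter, ← (Equiv.funUnique (Fin 1) ι).symm.sum_comp, Finset.sum_eq_single a]
    · simp [Matrix.one_apply]
    · intro x _ hx
      exact if_neg fun h => hx h.1
    · simp
  | succ n ih =>
    rw [List.ofFn_succ, List.prod_cons, Matrix.mul_apply]
    simp_rw [← ih, Finset.sum_filter, Finset.mul_sum]
    rw [← (Fin.consEquiv fun _ : Fin (n + 2) => ι).sum_comp, Fintype.sum_prod_type]
    simp only [Fin.consEquiv_apply, Fin.cons_zero, ← Fin.succ_last, Fin.cons_succ,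
      Fin.prod_univ_succ, Fin.castSucc_zero, ← Fin.succ_castSucc]
    rw [Finset.sum_eq_single a]
    · rw [Finset.sum_comm]
      refine Finset.sum_congr rfl fun r _ => ?_
      rw [Finset.sum_eq_single (r 0)]
      · simp
      · intro y _ hy
        simp [hy.symm]
      · simp
    · intro x _ hx
      simp [hx]
    · simp

/-- A labelling of a tree consists of the labels at its root and labellings of the subtrees. -/
def labellingEquiv (N n : ℕ) (child : Fin n → OrderedTree) :
    Labelling (node n child) N ≃ (Fin (n + 1) → Fin N) × ((i : Fin n) → Labelling (child i) N) where
  toFun x := (fun j => x ⟨none, j⟩, fun i p => x ⟨some ⟨i, p.1⟩, p.2⟩)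
  invFun y := fun p => match p with
    | ⟨none, j⟩ => y.1 j
    | ⟨some ⟨i, v⟩, j⟩ => y.2 i ⟨v, j⟩
  left_inv x := by
    funext p
    rcases p with ⟨_ | ⟨i, v⟩, j⟩ <;> rfl
  right_inv _ := rfl

/-- An edge of a tree is an edge at the root or an edge of a subtree. -/
def edgeEquiv (n : ℕ) (child : Fin n → OrderedTree) :
    Edge (node n child) ≃ Fin n ⊕ ((i : Fin n) × Edge (child i)) where
  toFun x := match x with
    | ⟨none, i⟩ => Sum.inl i
    | ⟨some ⟨i, v⟩, j⟩ => Sum.inr ⟨i, ⟨v, j⟩⟩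
  invFun x := match x with
    | Sum.inl i => ⟨none, i⟩
    | Sum.inr ⟨i, ⟨v, j⟩⟩ => ⟨some ⟨i, v⟩, j⟩
  left_inv := by rintro ⟨_ | ⟨i, v⟩, j⟩ <;> rfl
  right_inv := by rintro (i | ⟨i, ⟨v, j⟩⟩) <;> rfl

variable {N : ℕ} (S : Matrix (Fin N) (Fin N) ℂ →ₗ[ℂ] Matrix (Fin N) (Fin N) ℂ)

theorem apply_eq_sum_coeff (R : Matrix (Fin N) (Fin N) ℂ) (x t : Fin N) :
    S R x t = ∑ y, ∑ z, coeff S x y z t * R y z := by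
  conv_lhs => rw [Matrix.matrix_eq_sum_single R]
  simp only [map_sum, Matrix.sum_apply, coeff]
  refine Finset.sum_congr rfl fun y _ => Finset.sum_congr rfl fun z _ => ?_
  have h_single : Matrix.single y z (R y z) = R y z • Matrix.single y z (1 : ℂ) := by
    rw [Matrix.smul_single, smul_eq_mul, mul_one]
  rw [h_single, map_smul, Matrix.smul_apply, smul_eq_mul, mul_comm]

/-- The product over the edges of `Γ` that the labelling `x` contributes to `val S Γ`. -/
noncomputable def labelWeight (Γ : OrderedTree) (x : Labelling Γ N) : ℂ :=
  ∏ e : Edge Γ,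
    coeff S (x ⟨e.1, e.2.castSucc⟩) (x ⟨childOf Γ e.1 e.2, 0⟩)
      (x ⟨childOf Γ e.1 e.2, Fin.last _⟩) (x ⟨e.1, e.2.succ⟩)

theorem labelWeight_node (n : ℕ) (child : Fin n → OrderedTree)
    (r : Fin (n + 1) → Fin N) (y : (i : Fin n) → Labelling (child i) N) :
    labelWeight S (node n child) ((labellingEquiv N n child).symm (r, y)) =
      ∏ i, (coeff S (r i.castSucc) (y i ⟨root (child i), 0⟩)
        (y i ⟨root (child i), Fin.last _⟩) (r i.succ) * labelWeight S (child i) (y i)) := by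
  rw [Finset.prod_mul_distrib]
  unfold labelWeight
  rw [← (edgeEquiv n child).symm.prod_comp, Fintype.prod_sum_type, Fintype.prod_sigma]
  rfl

theorem apply_val (Γ : OrderedTree) (p q : Fin N) :
    S (val S Γ) p q = ∑ x : Labelling Γ N,
      coeff S p (x ⟨root Γ, 0⟩) (x ⟨root Γ, Fin.last _⟩) q * labelWeight S Γ x := by
  rw [apply_eq_sum_coeff]
  simp only [val, Matrix.of_apply, Finset.sum_filter, Finset.mul_sum]
  rw [← Fintype.sum_prod_type', Finset.sum_comm]
  refine Finset.sum_congr rfl fun x _ => ?_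
  rw [Finset.sum_eq_single (x ⟨root Γ, 0⟩, x ⟨root Γ, Fin.last _⟩)]
  · simp [labelWeight]
  · rintro ⟨y, z⟩ _ h
    rw [if_neg, mul_zero]
    rintro ⟨rfl, rfl⟩
    exact h rfl
  · simp

theorem val_node (n : ℕ) (child : Fin n → OrderedTree) :
    val S (node n child) = (List.ofFn fun i => S (val S (child i))).prod := by
  ext a b
  rw [← sum_paths_eq_prod]
  simp only [apply_val, Finset.prod_univ_sum, Fintype.piFinset_univ]
  change ∑ x : Labelling (node n child) N with x ⟨none, (0 : Fin (n + 1))⟩ = a ∧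
    x ⟨none, Fin.last n⟩ = b, labelWeight S (node n child) x = _
  rw [Finset.sum_filter, ← (labellingEquiv N n child).symm.sum_comp, Fintype.sum_prod_type,
    Finset.sum_filter]
  refine Finset.sum_congr rfl fun r _ => ?_
  simp only [labelWeight_node]
  change (∑ y : (i : Fin n) → Labelling (child i) N, if r 0 = a ∧ r (Fin.last n) = b then _ else _)
    = _
  split_ifs
  · rfl
  · simp

/-- Attach a new first subtree to the root. -/
def graft (Γ₁ : OrderedTree) : OrderedTree → OrderedTree
  | node n child => node (n + 1) (Fin.cons Γ₁ child : Fin (n + 1) → OrderedTree)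

theorem val_graft (Γ₁ Γ₂ : OrderedTree) :
    val S (graft Γ₁ Γ₂) = S (val S Γ₁) * val S Γ₂ := by
  cases Γ₂ with
  | node n child => simp [graft, val_node, List.ofFn_succ]

theorem numEdges_graft (Γ₁ Γ₂ : OrderedTree) :
    numEdges (graft Γ₁ Γ₂) = numEdges Γ₁ + numEdges Γ₂ + 1 := by
  cases Γ₂ with
  | node n child =>
    simp only [graft, numEdges_node, Fin.sum_univ_succ, Fin.cons_zero, Fin.cons_succ]
    omega

theorem graft_injective2 : Function.Injective2 graft := by
  rintro Γ₁ Γ₁' ⟨n, child⟩ ⟨n', child'⟩ h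
  obtain ⟨h_num, h_child⟩ := node.inj h
  obtain rfl : n = n' := Nat.succ_injective h_num
  obtain ⟨rfl, rfl⟩ := Fin.cons_injective2 (eq_of_heq h_child)
  exact ⟨rfl, rfl⟩

theorem exists_eq_graft {Γ : OrderedTree} (h : numEdges Γ ≠ 0) : ∃ Γ₁ Γ₂, Γ = graft Γ₁ Γ₂ := by
  obtain ⟨_ | n, child⟩ := Γ
  · simp [numEdges_node] at h
  · exact ⟨child 0, node n (Fin.tail child), by simp [graft, Fin.cons_self_tail]⟩

theorem mem_treesWithEdges {k : ℕ} {Γ : OrderedTree} :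
    Γ ∈ treesWithEdges k ↔ numEdges Γ = k := by
  simp [treesWithEdges]

theorem treesWithEdges_zero : treesWithEdges 0 = {node 0 Fin.elim0} := by
  ext ⟨n, child⟩
  rw [mem_treesWithEdges, Finset.mem_singleton, numEdges_node]
  constructor
  · intro h
    obtain rfl : n = 0 := by omega
    rw [Subsingleton.elim child Fin.elim0]
  · intro h
    obtain ⟨rfl, -⟩ := node.inj h
    simp

theorem sum_treesWithEdges_succ {α : Type*} [AddCommMonoid α] (f : OrderedTree → α) (k : ℕ) :
    ∑ Γ ∈ treesWithEdges (k + 1), f Γ = ∑ p ∈ antidiagonal k,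
      ∑ q ∈ treesWithEdges p.1 ×ˢ treesWithEdges p.2, f (graft q.1 q.2) := by
  rw [Finset.sum_sigma']
  symm
  refine Finset.sum_bij (fun x _ => graft x.2.1 x.2.2) ?_ ?_ ?_ fun _ _ => rfl
  · rintro ⟨⟨i, j⟩, Γ₁, Γ₂⟩ h
    simp only [Finset.mem_sigma, mem_antidiagonal, Finset.mem_product,
      mem_treesWithEdges] at h ⊢
    rw [numEdges_graft]
    omega
  · rintro ⟨⟨i, j⟩, Γ₁, Γ₂⟩ h ⟨⟨i', j'⟩, Γ₁', Γ₂'⟩ h' h_graft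
    simp only [Finset.mem_sigma, mem_antidiagonal, Finset.mem_product,
      mem_treesWithEdges] at h h'
    obtain ⟨rfl, rfl⟩ := graft_injective2 h_graft
    obtain ⟨-, rfl, rfl⟩ := h
    obtain ⟨-, rfl, rfl⟩ := h'
    rfl
  · intro Γ h
    rw [mem_treesWithEdges] at h
    obtain ⟨Γ₁, Γ₂, rfl⟩ := exists_eq_graft (h.trans_ne k.succ_ne_zero)
    rw [numEdges_graft] at h
    refine ⟨⟨(numEdges Γ₁, numEdges Γ₂), Γ₁, Γ₂⟩, ?_, rfl⟩
    simp only [Finset.mem_sigma, mem_antidiagonal, Finset.mem_product,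
      mem_treesWithEdges, and_self, and_true]
    omega

theorem isDysonRecursion_treeCoeff : IsDysonRecursion S (treeCoeff S) where
  zero := by simp [treeCoeff, treesWithEdges_zero, val_node]
  succ k := by
    simp only [treeCoeff, map_sum, Finset.sum_mul_sum, ← val_graft, ← Finset.sum_product',
      sum_treesWithEdges_succ]

end Trees

section EarleHamilton

theorem convex_setOf_ball_subset {E : Type*} [SeminormedAddCommGroup E] [NormedSpace ℝ E]
    {D : Set E} (hD : Convex ℝ D) (δ : ℝ) :
    Convex ℝ {x | Metric.ball x δ ⊆ D} := by
  intro x hx y hy a b ha hb hab w hw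
  rw [mem_ball_iff_norm] at hw
  have hx' : x + (w - (a • x + b • y)) ∈ D := hx (by simpa [mem_ball_iff_norm] using hw)
  have hy' : y + (w - (a • x + b • y)) ∈ D := hy (by simpa [mem_ball_iff_norm] using hw)
  convert hD hx' hy' ha hb hab using 1
  rw [smul_add, smul_add, add_add_add_comm, ← add_smul, hab, one_smul]
  abel

theorem isClosed_setOf_ball_subset {X : Type*} [PseudoMetricSpace X] (D : Set X) (δ : ℝ) :
    IsClosed {x | Metric.ball x δ ⊆ D} := by
  rw [← isSeqClosed_iff_isClosed]
  intro u x hu hux w hw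
  rw [Metric.mem_ball'] at hw
  obtain ⟨n, hn⟩ := ((hux.dist tendsto_const_nhds).eventually (gt_mem_nhds hw)).exists
  exact hu n (Metric.mem_ball'.2 hn)

variable {E : Type*} [NormedAddCommGroup E] [NormedSpace ℂ E] {D : Set E} {x v : E} {r B δ : ℝ}

/-- `CaratheodoryLE D x v r` says that the vector `v` at the point `x` has length at most `r` in the
infinitesimal Carathéodory metric of `D`: every holomorphic map from `D` to the closed unit ball has
derivative of norm at most `r` at `x` in the direction `v`. Maps with values in the ambient space
itself take the place of the usual functionals. -/
def CaratheodoryLE (D : Set E) (x v : E) (r : ℝ) : Prop :=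
  ∀ f : E → E, DifferentiableOn ℂ f D → (∀ y ∈ D, ‖f y‖ ≤ 1) → ‖fderiv ℂ f x v‖ ≤ r

theorem caratheodoryLE_of_ball_subset [CompleteSpace E] (hD : IsOpen D) (hδ : 0 < δ)
    (hx : Metric.ball x δ ⊆ D) (v : E) : CaratheodoryLE D x v (2 * ‖v‖ / δ) := by
  intro f hf hb
  rcases eq_or_ne v 0 with rfl | hv
  · simp
  have : 0 < ‖v‖ := norm_pos_iff.2 hv
  have h_radius : 0 < δ / (2 * ‖v‖) := by positivity
  have h_mem : ∀ w ∈ Metric.closedBall (0 : ℂ) (δ / (2 * ‖v‖)), x + w • v ∈ D := by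
    intro w hw
    apply hx
    rw [mem_closedBall_zero_iff] at hw
    rw [mem_ball_iff_norm, add_sub_cancel_left, norm_smul]
    calc ‖w‖ * ‖v‖ ≤ δ / (2 * ‖v‖) * ‖v‖ := by gcongr
      _ = δ / 2 := by field_simp
      _ < δ := by linarith
  have h_deriv : ∀ w ∈ Metric.closedBall (0 : ℂ) (δ / (2 * ‖v‖)),
      HasDerivAt (fun w : ℂ => f (x + w • v)) (fderiv ℂ f (x + w • v) v) w := fun w hw =>
    (hf.differentiableAt (hD.mem_nhds (h_mem w hw))).hasFDerivAt.comp_hasDerivAt w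
      (by simpa using ((hasDerivAt_id w).smul_const v).const_add x)
  have h_diffContOnCl : DiffContOnCl ℂ (fun w : ℂ => f (x + w • v))
      (Metric.ball (0 : ℂ) (δ / (2 * ‖v‖))) := by
    apply DifferentiableOn.diffContOnCl
    rw [closure_ball _ h_radius.ne']
    exact fun w hw => (h_deriv w hw).differentiableAt.differentiableWithinAt
  have h_cauchy := Complex.norm_deriv_le_of_forall_mem_sphere_norm_le h_radius h_diffContOnCl
    fun w hw => hb _ (h_mem w (Metric.sphere_subset_closedBall hw))
  rw [(h_deriv 0 (Metric.mem_closedBall_self h_radius.le)).deriv, zero_smul, add_zero] at h_cauchy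
  exact h_cauchy.trans_eq (one_div_div _ _)

theorem CaratheodoryLE.norm_le (h : CaratheodoryLE D x v r) (hB : 0 < B)
    (hDB : ∀ y ∈ D, ‖y‖ ≤ B) : ‖v‖ ≤ B * r := by
  have h_norm : ‖((B : ℂ)⁻¹)‖ = B⁻¹ := by
    rw [norm_inv, Complex.norm_real, Real.norm_of_nonneg hB.le]
  have h_scale := h (fun y => (B : ℂ)⁻¹ • y) (by fun_prop) fun y hy => by
    rw [norm_smul, h_norm, inv_mul_le_iff₀ hB, mul_one]
    exact hDB y hy
  have h_deriv : HasFDerivAt (fun y : E => (B : ℂ)⁻¹ • y)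
      ((B : ℂ)⁻¹ • ContinuousLinearMap.id ℂ E) x := (hasFDerivAt_id x).const_smul _
  rwa [h_deriv.fderiv, smul_apply, ContinuousLinearMap.id_apply, norm_smul,
    h_norm, inv_mul_le_iff₀ hB] at h_scale

variable {F : E → E}

theorem add_smul_sub_mem_of_ball_subset (hB : 0 < B) (hδ : 0 < δ) (hDB : ∀ y ∈ D, ‖y‖ ≤ B)
    (hFD : ∀ y ∈ D, Metric.ball (F y) δ ⊆ D) (hx : x ∈ D) {y : E} (hy : y ∈ D) :
    F y + ((δ / (4 * B) : ℝ) : ℂ) • (F y - F x) ∈ D := by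
  apply hFD y hy
  have hFy : ‖F y‖ ≤ B := hDB _ (hFD y hy (Metric.mem_ball_self hδ))
  have hFx : ‖F x‖ ≤ B := hDB _ (hFD x hx (Metric.mem_ball_self hδ))
  rw [mem_ball_iff_norm, add_sub_cancel_left, norm_smul, Complex.norm_real,
    Real.norm_of_nonneg (by positivity)]
  calc δ / (4 * B) * ‖F y - F x‖ ≤ δ / (4 * B) * (B + B) := by
        gcongr
        exact (norm_sub_le _ _).trans (add_le_add hFy hFx)
    _ = δ / 2 := by
        field_simp
        norm_num
    _ < δ := by linarith

/-- A holomorphic map of `D` into itself whose image stays `δ`-far from the complement contracts the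
Carathéodory metric: a test map `f` is composed with the dilation of `F` about `F x`, whose
derivative at `x` is larger than that of `F`. -/
theorem CaratheodoryLE.map (h : CaratheodoryLE D x v r) (hD : IsOpen D) (hB : 0 < B) (hδ : 0 < δ)
    (hDB : ∀ y ∈ D, ‖y‖ ≤ B) (hF : DifferentiableOn ℂ F D)
    (hFD : ∀ y ∈ D, Metric.ball (F y) δ ⊆ D) (hx : x ∈ D) :
    CaratheodoryLE D (F x) (fderiv ℂ F x v) ((1 + δ / (4 * B))⁻¹ * r) := by
  intro f hf hb
  set t : ℝ := δ / (4 * B)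
  have : 0 < t := by positivity
  set G : E → E := fun y => F y + (t : ℂ) • (F y - F x) with hG
  have hG_mem : ∀ y ∈ D, G y ∈ D := fun y => add_smul_sub_mem_of_ball_subset hB hδ hDB hFD hx
  have hG_diff : DifferentiableOn ℂ G D := by fun_prop
  have hGx : G x = F x := by simp [hG]
  have hF_deriv := (hF.differentiableAt (hD.mem_nhds hx)).hasFDerivAt
  have hG_deriv : HasFDerivAt G (fderiv ℂ F x + (t : ℂ) • fderiv ℂ F x) x :=
    hF_deriv.add ((hF_deriv.sub_const (F x)).const_smul (t : ℂ))
  have hf_diff : DifferentiableAt ℂ f (G x) := hf.differentiableAt (hD.mem_nhds (hG_mem x hx))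
  have h_comp : fderiv ℂ (f ∘ G) x v = ((1 + t : ℝ) : ℂ) • fderiv ℂ f (F x) (fderiv ℂ F x v) := by
    rw [fderiv_comp x hf_diff hG_deriv.differentiableAt, hG_deriv.fderiv, hGx]
    simp [add_smul]
  have h_test := h (f ∘ G) (hf.comp hG_diff hG_mem) fun y hy => hb _ (hG_mem y hy)
  rw [h_comp, norm_smul, Complex.norm_real, Real.norm_of_nonneg (by positivity)] at h_test
  rwa [le_inv_mul_iff₀ (by positivity)]

theorem CaratheodoryLE.iterate (h : CaratheodoryLE D x v r) (hD : IsOpen D) (hB : 0 < B)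
    (hδ : 0 < δ) (hDB : ∀ y ∈ D, ‖y‖ ≤ B) (hF : DifferentiableOn ℂ F D)
    (hFD : ∀ y ∈ D, Metric.ball (F y) δ ⊆ D) (hx : x ∈ D) (n : ℕ) :
    F^[n] x ∈ D ∧ DifferentiableAt ℂ F^[n] x ∧
      CaratheodoryLE D (F^[n] x) (fderiv ℂ F^[n] x v) ((1 + δ / (4 * B))⁻¹ ^ n * r) := by
  induction n with
  | zero => exact ⟨hx, differentiableAt_id, by simpa [fderiv_fun_id] using h⟩
  | succ n ih =>
    obtain ⟨h_mem, h_diff, h_le⟩ := ih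
    have hF_diff := hF.differentiableAt (hD.mem_nhds h_mem)
    rw [Function.iterate_succ']
    refine ⟨hFD _ h_mem (Metric.mem_ball_self hδ), hF_diff.comp x h_diff, ?_⟩
    rw [fderiv_comp x hF_diff h_diff, pow_succ', mul_assoc]
    exact h_le.map hD hB hδ hDB hF hFD h_mem

theorem norm_iterate_sub_le [CompleteSpace E] [NormedSpace ℝ E] (hD : IsOpen D)
    (hconv : Convex ℝ D) (hB : 0 < B) (hδ : 0 < δ) (hDB : ∀ y ∈ D, ‖y‖ ≤ B)
    (hF : DifferentiableOn ℂ F D) (hFD : ∀ y ∈ D, Metric.ball (F y) δ ⊆ D) {y : E}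
    (hx : Metric.ball x δ ⊆ D) (hy : Metric.ball y δ ⊆ D) (n : ℕ) :
    ‖F^[n] y - F^[n] x‖ ≤ 2 * B / δ * (1 + δ / (4 * B))⁻¹ ^ n * ‖y - x‖ := by
  have h_iterate (w : E) (hw : Metric.ball w δ ⊆ D) (v : E) :=
    (caratheodoryLE_of_ball_subset hD hδ hw v).iterate hD hB hδ hDB hF hFD
      (hw (Metric.mem_ball_self hδ)) n
  refine (convex_setOf_ball_subset hconv δ).norm_image_sub_le_of_norm_fderiv_le (𝕜 := ℂ)
    (fun w hw => (h_iterate w hw 0).2.1) (fun w hw => ?_) hx hy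
  refine ContinuousLinearMap.opNorm_le_bound _ (by positivity) fun v => ?_
  exact ((h_iterate w hw v).2.2.norm_le hB hDB).trans_eq (by ring)

/-- The **Earle–Hamilton fixed point theorem** on a bounded convex open set. -/
theorem existsUnique_fixedPoint_of_ball_subset [CompleteSpace E] [NormedSpace ℝ E] (hD : IsOpen D)
    (hconv : Convex ℝ D) (hne : D.Nonempty) (hB : 0 < B) (hδ : 0 < δ) (hDB : ∀ y ∈ D, ‖y‖ ≤ B)
    (hF : DifferentiableOn ℂ F D) (hFD : ∀ y ∈ D, Metric.ball (F y) δ ⊆ D) :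
    ∃! x, x ∈ D ∧ Function.IsFixedPt F x := by
  set q := (1 + δ / (4 * B))⁻¹
  have hq : q < 1 := inv_lt_one_of_one_lt₀ (lt_add_of_pos_right 1 (by positivity))
  have h_sub : {x | Metric.ball x δ ⊆ D} ⊆ D := fun x hx => hx (Metric.mem_ball_self hδ)
  have h_lip {x y : E} (hx : Metric.ball x δ ⊆ D) (hy : Metric.ball y δ ⊆ D) (n : ℕ) :
      ‖F^[n] y - F^[n] x‖ ≤ 2 * B / δ * q ^ n * ‖y - x‖ :=
    norm_iterate_sub_le hD hconv hB hδ hDB hF hFD hx hy n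
  obtain ⟨x₀, hx₀⟩ := hne
  have h_mapsTo : Set.MapsTo F {x | Metric.ball x δ ⊆ D} {x | Metric.ball x δ ⊆ D} :=
    fun x hx => hFD x (h_sub hx)
  have h_mem (n : ℕ) : Metric.ball (F^[n] (F x₀)) δ ⊆ D := h_mapsTo.iterate n (hFD x₀ hx₀)
  have h_cauchy : CauchySeq fun n => F^[n] (F x₀) := by
    refine cauchySeq_of_le_geometric q (2 * B / δ * ‖F (F x₀) - F x₀‖) hq fun n => ?_
    rw [dist_comm, dist_eq_norm, Function.iterate_succ_apply]
    exact (h_lip (h_mem 0) (h_mem 1) n).trans_eq (mul_right_comm _ _ _)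
  obtain ⟨x, hx⟩ := cauchySeq_tendsto_of_complete h_cauchy
  have hxD : Metric.ball x δ ⊆ D :=
    (isClosed_setOf_ball_subset D δ).mem_of_tendsto hx (Filter.Eventually.of_forall h_mem)
  have hx_fixed : Function.IsFixedPt F x :=
    isFixedPt_of_tendsto_iterate hx
      (hF.differentiableAt (hD.mem_nhds (h_sub hxD))).continuousAt
  refine ⟨x, ⟨h_sub hxD, hx_fixed⟩, ?_⟩
  rintro y ⟨hyD, hy_fixed⟩
  have h_le (n : ℕ) : ‖y - x‖ ≤ 2 * B / δ * q ^ n * ‖y - x‖ := by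
    have h := h_lip hxD (hy_fixed ▸ hFD y hyD) n
    rwa [hy_fixed.iterate n, hx_fixed.iterate n] at h
  have h_lim : Filter.Tendsto (fun n => 2 * B / δ * q ^ n * ‖y - x‖) Filter.atTop (nhds 0) := by
    simpa using ((tendsto_pow_atTop_nhds_zero_of_lt_one (by positivity) hq).const_mul
      (2 * B / δ)).mul_const ‖y - x‖
  exact sub_eq_zero.1 (norm_le_zero_iff.1 (ge_of_tendsto' h_lim h_le))

end EarleHamilton

section ImaginaryPart

theorem star_mul_algebraMap_mul_self {A : Type*} [Semiring A] [Star A] [Algebra ℝ A] (m : A)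
    (r : ℝ) : star m * algebraMap ℝ A r * m = r • (star m * m) := by
  rw [← Algebra.commutes, mul_assoc, ← Algebra.smul_def]

open scoped ComplexStarModule

variable {A : Type*} [Ring A] [StarRing A] [Algebra ℂ A] [StarModule ℂ A]

theorem imaginaryPart_eq_conjugate_of_mul_eq_neg_one {b m : A} (h : b * m = -1) :
    (ℑ m : A) = star m * ℑ b * m := by
  have h_star : star m * star b = -1 := by rw [← star_mul, h, star_neg, star_one]
  have h_sub : star m * (b - star b) * m = m - star m := by
    rw [mul_sub, sub_mul, mul_assoc, h, h_star]
    noncomm_ring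
  simp only [imaginaryPart_apply_coe, mul_smul_comm, smul_mul_assoc, h_sub]

theorem star_mul_self_sub_algebraMap_mul_I (b : A) (t : ℝ) :
    star (b - algebraMap ℂ A (t * Complex.I)) * (b - algebraMap ℂ A (t * Complex.I)) =
      star b * b - (2 * t) • (ℑ b : A) + algebraMap ℝ A (t ^ 2) := by
  have h_sq : algebraMap ℝ A (t ^ 2) = ((t : ℂ) ^ 2) • (1 : A) := by
    rw [Algebra.algebraMap_eq_smul_one, ← Complex.coe_smul, Complex.ofReal_pow]
  rw [imaginaryPart_apply_coe, h_sq]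
  simp only [← Complex.coe_smul, Algebra.algebraMap_eq_smul_one, star_sub, star_smul, star_one,
    sub_mul, mul_sub, smul_mul_assoc, mul_smul_comm, one_mul, mul_one, RCLike.star_def, map_mul,
    Complex.conj_I, Complex.conj_ofReal, smul_smul, smul_sub, Complex.ofReal_mul,
    Complex.ofReal_ofNat, Complex.ofReal_inv]
  match_scalars
  all_goals ring_nf
  all_goals rw [Complex.I_sq]
  all_goals ring

end ImaginaryPart

section HalfPlane

open scoped ComplexStarModule ComplexOrder

variable {A : Type*} [CStarAlgebra A] [PartialOrder A] [StarOrderedRing A]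

theorem norm_sq_le_of_star_mul_self_le {a : A} {r : ℝ} (hr : 0 ≤ r)
    (h : star a * a ≤ algebraMap ℝ A r) : ‖a‖ ^ 2 ≤ r := by
  rw [sq, ← CStarRing.norm_star_mul_self]
  exact (CStarAlgebra.norm_le_iff_le_algebraMap _ hr (star_mul_self_nonneg a)).2 h

/-- The idea: `‖b - i t‖ < t` for large `t`, so that `0` is not in the spectrum of `b`. -/
theorem isUnit_of_algebraMap_le_imaginaryPart {b : A} {η : ℝ} (hη : 0 < η)
    (hb : algebraMap ℝ A η ≤ ℑ b) : IsUnit b := by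
  nontriviality A
  set t : ℝ := ‖b‖ ^ 2 / (2 * η) + 2 * η with ht
  have ht_le : 2 * η ≤ t := le_add_of_nonneg_left (by positivity)
  have h_le : star (b - algebraMap ℂ A (t * Complex.I)) * (b - algebraMap ℂ A (t * Complex.I)) ≤
      algebraMap ℝ A (t ^ 2 - (2 * η) ^ 2) := calc
    _ = star b * b - (2 * t) • (ℑ b : A) + algebraMap ℝ A (t ^ 2) :=
      star_mul_self_sub_algebraMap_mul_I b t
    _ ≤ algebraMap ℝ A (‖b‖ ^ 2) - (2 * t) • algebraMap ℝ A η + algebraMap ℝ A (t ^ 2) := by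
      gcongr
      exact CStarAlgebra.star_mul_le_algebraMap_norm_sq
    _ = algebraMap ℝ A (t ^ 2 - (2 * η) ^ 2) := by
      rw [Algebra.smul_def, ← map_mul, ← map_sub, ← map_add]
      congr 1
      rw [ht]
      field_simp
      ring
  have h_norm : ‖b - algebraMap ℂ A (t * Complex.I)‖ < t := by
    have h_sq := norm_sq_le_of_star_mul_self_le (by nlinarith) h_le
    exact lt_of_pow_lt_pow_left₀ 2 (by linarith) (by nlinarith)
  have h_res : (t * Complex.I : ℂ) ∈ resolventSet ℂ (algebraMap ℂ A (t * Complex.I) - b) := by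
    apply spectrum.mem_resolventSet_of_norm_lt
    rwa [norm_sub_rev, norm_mul, Complex.norm_I, mul_one, Complex.norm_real,
      Real.norm_of_nonneg (by linarith)]
  rwa [spectrum.mem_resolventSet_iff, sub_sub_cancel] at h_res

theorem norm_le_inv_of_mul_eq_neg_one {b m : A} {η : ℝ} (hη : 0 < η)
    (hb : algebraMap ℝ A η ≤ ℑ b) (h : b * m = -1) : ‖m‖ ≤ η⁻¹ := by
  have h_smul : η • (star m * m) ≤ algebraMap ℝ A ‖m‖ := calc
    η • (star m * m) = star m * algebraMap ℝ A η * m := (star_mul_algebraMap_mul_self m η).symm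
    _ ≤ star m * ℑ b * m := star_left_conjugate_le_conjugate hb m
    _ = ℑ m := (imaginaryPart_eq_conjugate_of_mul_eq_neg_one h).symm
    _ ≤ algebraMap ℝ A ‖(ℑ m : A)‖ := (ℑ m).2.le_algebraMap_norm_self
    _ ≤ algebraMap ℝ A ‖m‖ := by
      gcongr
      exact imaginaryPart.norm_le m
  have h_sq : ‖m‖ ^ 2 ≤ η⁻¹ * ‖m‖ := by
    refine norm_sq_le_of_star_mul_self_le (by positivity) ?_
    rwa [map_mul, ← Algebra.smul_def, le_inv_smul_iff_of_pos hη]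
  rcases (norm_nonneg m).eq_or_lt with h_zero | h_pos
  · rw [← h_zero]
    positivity
  · exact le_of_mul_le_mul_right (by linarith) h_pos

theorem one_le_smul_star_mul_self_of_mul_eq_neg_one {b m : A} (h : b * m = -1) :
    (1 : A) ≤ ‖b‖ ^ 2 • (star m * m) := calc
  (1 : A) = star (b * m) * (b * m) := by rw [h, star_neg, star_one, neg_mul_neg, one_mul]
  _ = star m * (star b * b) * m := by rw [star_mul]; noncomm_ring
  _ ≤ star m * algebraMap ℝ A (‖b‖ ^ 2) * m :=
    star_left_conjugate_le_conjugate CStarAlgebra.star_mul_le_algebraMap_norm_sq m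
  _ = ‖b‖ ^ 2 • (star m * m) := star_mul_algebraMap_mul_self m _

theorem algebraMap_div_le_smul_star_mul_self {b m : A} {η C : ℝ} (hη : 0 ≤ η) (hC : 0 < C)
    (hbC : ‖b‖ ≤ C) (h : b * m = -1) : algebraMap ℝ A (η / C ^ 2) ≤ η • (star m * m) := calc
  algebraMap ℝ A (η / C ^ 2) = (η / C ^ 2) • 1 := Algebra.algebraMap_eq_smul_one _
  _ ≤ (η / C ^ 2) • ‖b‖ ^ 2 • (star m * m) := by
    gcongr
    exact one_le_smul_star_mul_self_of_mul_eq_neg_one h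
  _ ≤ (η / C ^ 2) • C ^ 2 • (star m * m) := by
    gcongr
    exact star_mul_self_nonneg m
  _ = η • (star m * m) := by rw [smul_smul, div_mul_cancel₀ _ (by positivity)]

theorem algebraMap_div_le_imaginaryPart_of_mul_eq_neg_one {b m : A} {η C : ℝ} (hη : 0 ≤ η)
    (hC : 0 < C) (hb : algebraMap ℝ A η ≤ ℑ b) (hbC : ‖b‖ ≤ C) (h : b * m = -1) :
    algebraMap ℝ A (η / C ^ 2) ≤ ℑ m := calc
  algebraMap ℝ A (η / C ^ 2) ≤ η • (star m * m) := algebraMap_div_le_smul_star_mul_self hη hC hbC h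
  _ = star m * algebraMap ℝ A η * m := (star_mul_algebraMap_mul_self m η).symm
  _ ≤ star m * ℑ b * m := star_left_conjugate_le_conjugate hb m
  _ = ℑ m := (imaginaryPart_eq_conjugate_of_mul_eq_neg_one h).symm

variable (A) in
/-- The operator upper half-plane, i.e. the elements whose imaginary part is strictly positive. The
uniform lower bound makes it visible that this set is open. -/
def upperHalfPlane : Set A := {m | ∃ δ > 0, algebraMap ℝ A δ ≤ ℑ m}

theorem mem_upperHalfPlane_iff {m : A} :
    m ∈ upperHalfPlane A ↔ IsStrictlyPositive (ℑ m : A) := by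
  constructor
  · rintro ⟨δ, hδ, h⟩
    refine IsStrictlyPositive.of_le ?_ h
    exact IsStrictlyPositive.iff_of_unital.2
      ⟨algebraMap_nonneg A hδ.le, (IsUnit.mk0 δ hδ.ne').map _⟩
  · intro h
    rcases subsingleton_or_nontrivial A
    · exact ⟨1, one_pos, (Subsingleton.elim _ _).le⟩
    · exact (CFC.exists_pos_algebraMap_le_iff (ℑ m).2).2 fun x hx => h.spectrum_pos hx

theorem algebraMap_sub_le_imaginaryPart {m w : A} {δ : ℝ}
    (hm : algebraMap ℝ A δ ≤ ℑ m) : algebraMap ℝ A (δ - ‖w - m‖) ≤ ℑ w := by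
  have h_neg : -algebraMap ℝ A ‖w - m‖ ≤ ℑ (w - m) := calc
    -algebraMap ℝ A ‖w - m‖ ≤ -algebraMap ℝ A ‖(ℑ (w - m) : A)‖ := by
      gcongr
      exact imaginaryPart.norm_le (w - m)
    _ ≤ ℑ (w - m) := (ℑ (w - m)).2.neg_algebraMap_norm_le_self
  calc algebraMap ℝ A (δ - ‖w - m‖) = algebraMap ℝ A δ + -algebraMap ℝ A ‖w - m‖ := by
        rw [map_sub, sub_eq_add_neg]
    _ ≤ ℑ m + ℑ (w - m) := add_le_add hm h_neg
    _ = ℑ w := by simp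

theorem ball_subset_upperHalfPlane {m : A} {δ : ℝ} (hm : algebraMap ℝ A δ ≤ ℑ m) :
    Metric.ball m δ ⊆ upperHalfPlane A := fun w hw =>
  ⟨δ - ‖w - m‖, sub_pos.2 (mem_ball_iff_norm.1 hw), algebraMap_sub_le_imaginaryPart hm⟩

theorem isOpen_upperHalfPlane : IsOpen (upperHalfPlane A) :=
  Metric.isOpen_iff.2 fun _ ⟨δ, hδ, h⟩ => ⟨δ, hδ, ball_subset_upperHalfPlane h⟩

theorem convex_upperHalfPlane : Convex ℝ (upperHalfPlane A) := by
  rintro x ⟨δ, hδ, hx⟩ y ⟨δ', hδ', hy⟩ a b ha hb hab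
  refine ⟨a * δ + b * δ', convex_Ioi (0 : ℝ) hδ hδ' ha hb hab, ?_⟩
  rw [map_add, map_add, map_smul, map_smul, map_mul, map_mul, ← Algebra.smul_def,
    ← Algebra.smul_def]
  exact add_le_add (smul_le_smul_of_nonneg_left hx ha) (smul_le_smul_of_nonneg_left hy hb)

variable (S : A →ₚ[ℂ] A) {z : ℂ} {m : A}

theorem imaginaryPart_smul_one_add_apply (z : ℂ) (m : A) :
    (ℑ (z • 1 + S m) : A) = algebraMap ℝ A z.im + S (ℑ m : A) := by
  have h_scalar : (ℑ (z • (1 : A)) : A) = algebraMap ℝ A z.im := by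
    simp [imaginaryPart_smul, Algebra.algebraMap_eq_smul_one]
  rw [map_add, AddMemClass.coe_add, h_scalar, ← map_imaginaryPart S m]

theorem algebraMap_im_le_imaginaryPart_add (z : ℂ) (hm : m ∈ upperHalfPlane A) :
    algebraMap ℝ A z.im ≤ ℑ (z • 1 + S m) := by
  rw [imaginaryPart_smul_one_add_apply]
  exact le_add_of_nonneg_right (map_nonneg S (mem_upperHalfPlane_iff.1 hm).nonneg)

/-- The map `m ↦ -(z + S m)⁻¹`, whose fixed points in the upper half-plane are the solutions of the
Dyson equation there. It has the junk value `0` where `z + S m` is not invertible. -/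
noncomputable def dysonMap (z : ℂ) (m : A) : A := -Ring.inverse (z • 1 + S m)

theorem mul_dysonMap (hz : 0 < z.im) (hm : m ∈ upperHalfPlane A) :
    (z • 1 + S m) * dysonMap S z m = -1 := by
  have h_unit := isUnit_of_algebraMap_le_imaginaryPart hz
    (algebraMap_im_le_imaginaryPart_add S z hm)
  rw [dysonMap, mul_neg, Ring.mul_inverse_cancel _ h_unit]

theorem isFixedPt_dysonMap_iff (hz : 0 < z.im) (hm : m ∈ upperHalfPlane A) :
    Function.IsFixedPt (dysonMap S z) m ↔ (z • 1 + S m) * m = -1 := by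
  have h_unit := isUnit_of_algebraMap_le_imaginaryPart hz
    (algebraMap_im_le_imaginaryPart_add S z hm)
  rw [Function.IsFixedPt, ← mul_dysonMap S hz hm, h_unit.mul_right_inj, eq_comm]

theorem norm_dysonMap_le (hz : 0 < z.im) (hm : m ∈ upperHalfPlane A) :
    ‖dysonMap S z m‖ ≤ z.im⁻¹ :=
  norm_le_inv_of_mul_eq_neg_one hz (algebraMap_im_le_imaginaryPart_add S z hm)
    (mul_dysonMap S hz hm)

theorem differentiableOn_dysonMap (hz : 0 < z.im) :
    DifferentiableOn ℂ (dysonMap S z) (upperHalfPlane A) := by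
  obtain ⟨κ, hκ⟩ := S.exists_norm_apply_le
  intro m hm
  have h_unit := isUnit_of_algebraMap_le_imaginaryPart hz
    (algebraMap_im_le_imaginaryPart_add S z hm)
  have h_diff : DifferentiableAt ℂ S m := (S.toLinearMap.mkContinuous κ hκ).differentiableAt
  exact ((differentiableAt_inverse h_unit).comp m (h_diff.const_add _)).neg.differentiableWithinAt

theorem exists_pos_algebraMap_le_imaginaryPart_dysonMap (hz : 0 < z.im) (r : ℝ) :
    ∃ δ > 0, ∀ m ∈ upperHalfPlane A, ‖m‖ < r → algebraMap ℝ A δ ≤ ℑ (dysonMap S z m) := by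
  obtain ⟨κ, hκ⟩ := S.exists_norm_apply_le
  refine ⟨z.im / (‖z • (1 : A)‖ + κ * |r| + 1) ^ 2, by positivity, fun m hm hr => ?_⟩
  refine algebraMap_div_le_imaginaryPart_of_mul_eq_neg_one hz.le (by positivity)
    (algebraMap_im_le_imaginaryPart_add S z hm) ?_ (mul_dysonMap S hz hm)
  calc ‖z • 1 + S m‖ ≤ ‖z • (1 : A)‖ + ‖S m‖ := norm_add_le _ _
    _ ≤ ‖z • (1 : A)‖ + κ * |r| := by
      gcongr
      exact (hκ m).trans (by gcongr; exact hr.le.trans (le_abs_self r))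
    _ ≤ ‖z • (1 : A)‖ + κ * |r| + 1 := by linarith

theorem existsUnique_dyson (hz : 0 < z.im) :
    ∃! m : A, (z • 1 + S m) * m = -1 ∧ m ∈ upperHalfPlane A := by
  set r : ℝ := z.im⁻¹ + 1
  have hr : 1 < r := lt_add_of_pos_left 1 (inv_pos.2 hz)
  have h_nonempty : (upperHalfPlane A ∩ Metric.ball 0 r).Nonempty := by
    refine ⟨Complex.I • 1, ⟨1, one_pos, by simp [imaginaryPart_I_smul]⟩, mem_ball_zero_iff.2 ?_⟩
    rcases subsingleton_or_nontrivial A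
    · rw [Subsingleton.elim (Complex.I • (1 : A)) 0, norm_zero]
      positivity
    · rwa [norm_smul, Complex.norm_I, norm_one, one_mul]
  obtain ⟨δ, hδ, h_im⟩ := exists_pos_algebraMap_le_imaginaryPart_dysonMap S hz r
  have h_ball : ∀ m ∈ upperHalfPlane A ∩ Metric.ball 0 r,
      Metric.ball (dysonMap S z m) (min δ 1) ⊆ upperHalfPlane A ∩ Metric.ball 0 r := by
    intro m hm
    refine Set.subset_inter
      ((Metric.ball_subset_ball (min_le_left δ 1)).trans
        (ball_subset_upperHalfPlane (h_im m hm.1 (mem_ball_zero_iff.1 hm.2))))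
      (Metric.ball_subset_ball' ?_)
    rw [dist_zero_right]
    linarith [min_le_right δ 1, norm_dysonMap_le S hz hm.1]
  have h_convex : Convex ℝ (upperHalfPlane A ∩ Metric.ball 0 r) :=
    convex_upperHalfPlane.inter (convex_ball (0 : A) r)
  have h_bounded : ∀ m ∈ upperHalfPlane A ∩ Metric.ball 0 r, ‖m‖ ≤ r := fun _ hm =>
    (mem_ball_zero_iff.1 hm.2).le
  obtain ⟨m, ⟨hm, h_fixed⟩, h_unique⟩ := existsUnique_fixedPoint_of_ball_subset
    (isOpen_upperHalfPlane.inter Metric.isOpen_ball) h_convex h_nonempty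
    (zero_lt_one.trans hr) (lt_min hδ one_pos) h_bounded
    ((differentiableOn_dysonMap S hz).mono Set.inter_subset_left) h_ball
  refine ⟨m, ⟨(isFixedPt_dysonMap_iff S hz hm.1).1 h_fixed, hm.1⟩, ?_⟩
  rintro w ⟨hw, hwU⟩
  have hw_fixed := (isFixedPt_dysonMap_iff S hz hwU).2 hw
  have hw_norm : ‖w‖ ≤ z.im⁻¹ := by
    rw [← hw_fixed.eq]
    exact norm_dysonMap_le S hz hwU
  exact h_unique w ⟨⟨hwU, mem_ball_zero_iff.2 (by linarith)⟩, hw_fixed⟩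

/-- `ℑ m` is a fixed point of `X ↦ (Im z) m* m + m* (S X) m`. Under the assumption on the iterates
of the linear part, it is the Neumann series of `(Im z) m* m`, hence at least its first term. -/
theorem mem_upperHalfPlane_of_tendsto_iterate (hz : 0 < z.im) (h : (z • 1 + S m) * m = -1)
    (h_lim : Filter.Tendsto (fun n => (fun x => star m * S x * m)^[n] (ℑ m : A)) Filter.atTop
      (nhds 0)) : m ∈ upperHalfPlane A := by
  set T : A → A := fun x => star m * S x * m
  have hT : Monotone T := fun x y hxy =>
    star_left_conjugate_le_conjugate (OrderHomClass.mono S hxy) m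
  have h_fixed : (ℑ m : A) = z.im • (star m * m) + T (ℑ m : A) := calc
    (ℑ m : A) = star m * ℑ (z • 1 + S m) * m := imaginaryPart_eq_conjugate_of_mul_eq_neg_one h
    _ = z.im • (star m * m) + T (ℑ m : A) := by
      rw [imaginaryPart_smul_one_add_apply, mul_add, add_mul, star_mul_algebraMap_mul_self]
  have h_le : T (ℑ m : A) ≤ ℑ m := by
    conv_rhs => rw [h_fixed]
    exact le_add_of_nonneg_left (smul_nonneg hz.le (star_mul_self_nonneg m))
  have h_nonneg : 0 ≤ T (ℑ m : A) := (hT.antitone_iterate_of_map_le h_le).le_of_tendsto h_lim 1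
  refine ⟨z.im / (‖z • 1 + S m‖ + 1) ^ 2, by positivity, ?_⟩
  calc algebraMap ℝ A (z.im / (‖z • 1 + S m‖ + 1) ^ 2) ≤ z.im • (star m * m) :=
        algebraMap_div_le_smul_star_mul_self hz.le (by positivity) (by linarith) h
    _ ≤ z.im • (star m * m) + T (ℑ m : A) := le_add_of_nonneg_right h_nonneg
    _ = ℑ m := h_fixed.symm

end HalfPlane

section DysonSeries

theorem catalan_le_four_pow (k : ℕ) : catalan k ≤ 4 ^ k := calc
  catalan k = k.centralBinom / (k + 1) := catalan_eq_centralBinom_div k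
  _ ≤ k.centralBinom := Nat.div_le_self _ _
  _ ≤ 2 ^ (2 * k) := Nat.choose_le_two_pow _ _
  _ = 4 ^ k := by rw [pow_mul]; norm_num

theorem IsDysonRecursion.map_le_catalan {F A : Type*} [Ring A] [FunLike F A ℝ]
    [RingSeminormClass F A ℝ] {p : F} {S : A → A} {C : ℕ → A} {κ : ℝ} (hC : IsDysonRecursion S C)
    (hp : p 1 ≤ 1) (hκ : 0 ≤ κ) (hS : ∀ a, p (S a) ≤ κ * p a) (k : ℕ) :
    p (C k) ≤ catalan k * κ ^ k := by
  induction k using Nat.strong_induction_on with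
  | _ k ih =>
    cases k with
    | zero => simpa [hC.zero] using hp
    | succ k =>
      rw [hC.succ, catalan_succ', Nat.cast_sum, Finset.sum_mul]
      refine (Finset.le_sum_of_subadditive p (map_zero p).le (map_add_le_add p) _ _).trans
        (Finset.sum_le_sum fun q hq => ?_)
      obtain rfl := mem_antidiagonal.1 hq
      calc p (S (C q.1) * C q.2) ≤ p (S (C q.1)) * p (C q.2) := map_mul_le_mul p _ _
        _ ≤ κ * p (C q.1) * p (C q.2) := by
          gcongr
          exact hS _
        _ ≤ κ * (catalan q.1 * κ ^ q.1) * (catalan q.2 * κ ^ q.2) := by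
          gcongr
          exacts [ih _ (by omega), ih _ (by omega)]
        _ = (catalan q.1 * catalan q.2 : ℕ) * κ ^ (q.1 + q.2 + 1) := by
          push_cast
          ring

theorem IsDysonRecursion.map_le_four_mul_pow {F A : Type*} [Ring A] [FunLike F A ℝ]
    [RingSeminormClass F A ℝ] {p : F} {S : A → A} {C : ℕ → A} {κ : ℝ} (hC : IsDysonRecursion S C)
    (hp : p 1 ≤ 1) (hκ : 0 ≤ κ) (hS : ∀ a, p (S a) ≤ κ * p a) (k : ℕ) :
    p (C k) ≤ (4 * κ) ^ k := calc
  p (C k) ≤ catalan k * κ ^ k := hC.map_le_catalan hp hκ hS k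
  _ ≤ 4 ^ k * κ ^ k := by
    gcongr
    exact_mod_cast catalan_le_four_pow k
  _ = (4 * κ) ^ k := (mul_pow _ _ _).symm

/-- The terms of the Laurent series `-∑_k C_k z^{-2k-1}`, with coefficients in any complex vector
space. -/
noncomputable def laurentTerm {V : Type*} [AddCommGroup V] [Module ℂ V] (C : ℕ → V) (z : ℂ)
    (k : ℕ) : V :=
  -((z ^ (2 * k + 1))⁻¹ • C k)

theorem map_laurentTerm_le {F V : Type*} [AddCommGroup V] [Module ℂ V] [FunLike F V ℝ]
    [SeminormClass F ℂ V] (p : F) {C : ℕ → V} {R : ℝ} {k : ℕ} (hC : p (C k) ≤ R ^ k) (z : ℂ) :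
    p (laurentTerm C z k) ≤ ‖z‖⁻¹ * (R / ‖z‖ ^ 2) ^ k := calc
  p (laurentTerm C z k) = (‖z‖ ^ (2 * k + 1))⁻¹ * p (C k) := by
    rw [laurentTerm, map_neg_eq_map, map_smul_eq_mul, norm_inv, norm_pow]
  _ ≤ (‖z‖ ^ (2 * k + 1))⁻¹ * R ^ k := by gcongr
  _ = ‖z‖⁻¹ * (R / ‖z‖ ^ 2) ^ k := by
    rw [pow_succ, pow_mul, mul_inv, div_pow]
    ring

theorem hasSum_mul_div_sq_pow {R r : ℝ} (hR : 0 ≤ R) (hr : R < r ^ 2) :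
    HasSum (fun k : ℕ => r⁻¹ * (R / r ^ 2) ^ k) (r⁻¹ * (1 - R / r ^ 2)⁻¹) :=
  (hasSum_geometric_of_lt_one (by positivity)
    ((div_lt_one (hR.trans_lt hr)).2 hr)).mul_left _

theorem map_le_of_hasSum {F V : Type*} [AddCommGroup V] [TopologicalSpace V] [FunLike F V ℝ]
    [AddGroupSeminormClass F V ℝ] {p : F} (hp : Continuous p) {f : ℕ → V} {b : ℕ → ℝ} {a : V}
    {r : ℝ} (hf : HasSum f a) (hb : HasSum b r) (h : ∀ k, p (f k) ≤ b k) : p a ≤ r :=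
  le_of_tendsto_of_tendsto ((hp.tendsto a).comp hf) hb <| Filter.Eventually.of_forall fun s =>
    (Finset.le_sum_of_subadditive p (map_zero p).le (map_add_le_add p) s f).trans
      (Finset.sum_le_sum fun k _ => h k)

theorem map_iterate_le {V : Type*} {p : V → ℝ} {T : V → V} {r : ℝ} (hr : 0 ≤ r)
    (hT : ∀ x, p (T x) ≤ r * p x) (n : ℕ) (x : V) : p (T^[n] x) ≤ r ^ n * p x := by
  induction n with
  | zero => simp
  | succ n ih =>
    rw [Function.iterate_succ_apply', pow_succ', mul_assoc]
    exact (hT _).trans (by gcongr)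

theorem IsDysonRecursion.sum_antidiagonal_laurentTerm {A : Type*} [Ring A] [Algebra ℂ A]
    {S : A →ₗ[ℂ] A} {C : ℕ → A} {z : ℂ} (hC : IsDysonRecursion S C) (hz : z ≠ 0) (k : ℕ) :
    ∑ p ∈ antidiagonal k, S (laurentTerm C z p.1) * laurentTerm C z p.2 =
      -(z • laurentTerm C z (k + 1)) := by
  have h_term : ∀ p ∈ antidiagonal k, S (laurentTerm C z p.1) * laurentTerm C z p.2 =
      (z ^ (2 * k + 2))⁻¹ • (S (C p.1) * C p.2) := by
    intro p hp
    obtain rfl := mem_antidiagonal.1 hp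
    simp only [laurentTerm, map_neg, map_smul, neg_mul_neg, smul_mul_smul_comm]
    rw [← mul_inv, ← pow_add]
    congr 3
    ring
  rw [Finset.sum_congr rfl h_term, ← Finset.smul_sum, ← hC.succ, laurentTerm, smul_neg, neg_neg,
    smul_smul, show 2 * (k + 1) + 1 = 2 * k + 2 + 1 by ring, pow_succ z (2 * k + 2), mul_inv_rev,
    mul_inv_cancel_left₀ hz]

theorem IsDysonRecursion.dyson_tsum_laurentTerm {A : Type*} [NormedRing A] [NormedAlgebra ℂ A]
    [CompleteSpace A] {S : A →L[ℂ] A} {C : ℕ → A} {z : ℂ} (hC : IsDysonRecursion S C) (hz : z ≠ 0)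
    (h_norm : Summable fun k => ‖laurentTerm C z k‖) :
    (z • 1 + S (∑' k, laurentTerm C z k)) * ∑' k, laurentTerm C z k = -1 := by
  have h_sum : Summable (laurentTerm C z) := h_norm.of_norm
  have h_norm_apply : Summable fun k => ‖S (laurentTerm C z k)‖ :=
    (h_norm.mul_left ‖S‖).of_nonneg_of_le (fun _ => norm_nonneg _) fun _ => S.le_opNorm _
  have h_mul : S (∑' k, laurentTerm C z k) * ∑' k, laurentTerm C z k =
      -(z • ∑' k, laurentTerm C z (k + 1)) := by
    rw [S.map_tsum h_sum, tsum_mul_tsum_eq_tsum_sum_antidiagonal_of_summable_norm h_norm_apply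
      h_norm, ← tsum_const_smul'', ← tsum_neg]
    exact tsum_congr (hC.sum_antidiagonal_laurentTerm (S := S.toLinearMap) hz)
  have h_zero : z • laurentTerm C z 0 = -1 := by simp [laurentTerm, hC.zero, smul_smul, hz]
  rw [add_mul, h_mul, smul_mul_assoc, one_mul, ← sub_eq_add_neg, ← smul_sub,
    h_sum.tsum_eq_zero_add, add_sub_cancel_right, h_zero]

end DysonSeries

section SchurNorm

open scoped Matrix

/-- A weight on pairs of indices which is compatible with matrix multiplication, such as the
exponential of a metric. -/
structure IsSubmultiplicativeWeight {ι : Type*} (w : ι → ι → ℝ) : Prop where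
  one_le (x y : ι) : 1 ≤ w x y
  self (x : ι) : w x x = 1
  le_mul (x y z : ι) : w x z ≤ w x y * w y z

theorem IsSubmultiplicativeWeight.nonneg {ι : Type*} {w : ι → ι → ℝ}
    (hw : IsSubmultiplicativeWeight w) (x y : ι) : 0 ≤ w x y :=
  zero_le_one.trans (hw.one_le x y)

variable {ι : Type*} [Fintype ι]

/-- The `ℓ¹` norm of the row `a` of `A` with respect to the weight `w`. -/
noncomputable def weightedRowSum (w : ι → ι → ℝ) (A : Matrix ι ι ℂ) (a : ι) : ℝ :=
  ∑ b, w a b * ‖A a b‖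

/-- The largest weighted `ℓ¹` norm of a row of `A` or of `Aᴴ`. The name refers to Schur's test,
which bounds operator norms in this way. -/
noncomputable def schurNorm (w : ι → ι → ℝ) (A : Matrix ι ι ℂ) : ℝ :=
  ⨆ a, max (weightedRowSum w A a) (weightedRowSum w Aᴴ a)

variable {w : ι → ι → ℝ} {A B : Matrix ι ι ℂ}

theorem weightedRowSum_nonneg (hw : ∀ x y, 0 ≤ w x y) (A : Matrix ι ι ℂ) (a : ι) :
    0 ≤ weightedRowSum w A a :=
  Finset.sum_nonneg fun b _ => mul_nonneg (hw a b) (norm_nonneg _)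

theorem weightedRowSum_add_le (hw : ∀ x y, 0 ≤ w x y) (A B : Matrix ι ι ℂ) (a : ι) :
    weightedRowSum w (A + B) a ≤ weightedRowSum w A a + weightedRowSum w B a := by
  simp only [weightedRowSum, ← Finset.sum_add_distrib, ← mul_add]
  gcongr with b
  · exact hw a b
  · exact norm_add_le _ _

theorem weightedRowSum_smul (w : ι → ι → ℝ) (z : ℂ) (A : Matrix ι ι ℂ) (a : ι) :
    weightedRowSum w (z • A) a = ‖z‖ * weightedRowSum w A a := by
  simp only [weightedRowSum, Matrix.smul_apply, norm_smul, Finset.mul_sum, mul_left_comm]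

theorem weightedRowSum_mul_le (hw : IsSubmultiplicativeWeight w) {r : ℝ}
    (hB : ∀ c, weightedRowSum w B c ≤ r) (A : Matrix ι ι ℂ) (a : ι) :
    weightedRowSum w (A * B) a ≤ weightedRowSum w A a * r := calc
  weightedRowSum w (A * B) a ≤ ∑ b, ∑ c, (w a c * ‖A a c‖) * (w c b * ‖B c b‖) := by
    refine Finset.sum_le_sum fun b _ => ?_
    calc w a b * ‖(A * B) a b‖ ≤ w a b * ∑ c, ‖A a c * B c b‖ :=
          mul_le_mul_of_nonneg_left (norm_sum_le _ _) (hw.nonneg a b)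
      _ = ∑ c, w a b * (‖A a c‖ * ‖B c b‖) := by simp only [norm_mul, Finset.mul_sum]
      _ ≤ ∑ c, w a c * w c b * (‖A a c‖ * ‖B c b‖) := by
        gcongr with c
        exact hw.le_mul a c b
      _ = ∑ c, w a c * ‖A a c‖ * (w c b * ‖B c b‖) := by simp only [mul_mul_mul_comm]
  _ = ∑ c, (w a c * ‖A a c‖) * weightedRowSum w B c := by
    rw [Finset.sum_comm]
    simp only [weightedRowSum, Finset.mul_sum]
  _ ≤ ∑ c, (w a c * ‖A a c‖) * r := by
    gcongr with c
    · exact mul_nonneg (hw.nonneg a c) (norm_nonneg _)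
    · exact hB c
  _ = weightedRowSum w A a * r := (Finset.sum_mul _ _ _).symm

theorem schurNorm_le {r : ℝ} (hr : 0 ≤ r) (h : ∀ a, weightedRowSum w A a ≤ r)
    (h_star : ∀ a, weightedRowSum w Aᴴ a ≤ r) : schurNorm w A ≤ r :=
  Real.iSup_le (fun a => max_le (h a) (h_star a)) hr

theorem schurNorm_conjTranspose (w : ι → ι → ℝ) (A : Matrix ι ι ℂ) :
    schurNorm w Aᴴ = schurNorm w A := by
  simp only [schurNorm, Matrix.conjTranspose_conjTranspose, max_comm]

theorem weightedRowSum_le_schurNorm (w : ι → ι → ℝ) (A : Matrix ι ι ℂ) (a : ι) :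
    weightedRowSum w A a ≤ schurNorm w A :=
  (le_max_left _ _).trans <|
    le_ciSup (f := fun a => max (weightedRowSum w A a) (weightedRowSum w Aᴴ a))
      (Set.finite_range _).bddAbove a

theorem weightedRowSum_conjTranspose_le_schurNorm (w : ι → ι → ℝ) (A : Matrix ι ι ℂ) (a : ι) :
    weightedRowSum w Aᴴ a ≤ schurNorm w A :=
  (weightedRowSum_le_schurNorm w Aᴴ a).trans_eq (schurNorm_conjTranspose w A)

theorem schurNorm_nonneg (hw : ∀ x y, 0 ≤ w x y) (A : Matrix ι ι ℂ) : 0 ≤ schurNorm w A :=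
  Real.iSup_nonneg fun a => le_max_of_le_left (weightedRowSum_nonneg hw A a)

theorem mul_norm_le_schurNorm (hw : ∀ x y, 0 ≤ w x y) (A : Matrix ι ι ℂ) (a b : ι) :
    w a b * ‖A a b‖ ≤ schurNorm w A :=
  (Finset.single_le_sum (f := fun b => w a b * ‖A a b‖)
    (fun b _ => mul_nonneg (hw a b) (norm_nonneg _)) (Finset.mem_univ b)).trans
    (weightedRowSum_le_schurNorm w A a)

theorem norm_apply_le_schurNorm (hw : IsSubmultiplicativeWeight w) (A : Matrix ι ι ℂ) (a b : ι) :
    ‖A a b‖ ≤ schurNorm w A :=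
  (le_mul_of_one_le_left (norm_nonneg _) (hw.one_le a b)).trans
    (mul_norm_le_schurNorm hw.nonneg A a b)

theorem schurNorm_one_le [DecidableEq ι] (hw : IsSubmultiplicativeWeight w) :
    schurNorm w (1 : Matrix ι ι ℂ) ≤ 1 := by
  have h_row (a : ι) : weightedRowSum w (1 : Matrix ι ι ℂ) a ≤ 1 := by
    simp [weightedRowSum, Matrix.one_apply, apply_ite, hw.self]
  refine schurNorm_le zero_le_one h_row ?_
  rwa [Matrix.conjTranspose_one]

theorem schurNorm_smul (w : ι → ι → ℝ) (z : ℂ) (A : Matrix ι ι ℂ) :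
    schurNorm w (z • A) = ‖z‖ * schurNorm w A := by
  simp only [schurNorm, Matrix.conjTranspose_smul, weightedRowSum_smul, norm_star,
    ← mul_max_of_nonneg _ _ (norm_nonneg z), Real.mul_iSup_of_nonneg (norm_nonneg z)]

theorem schurNorm_add_le (hw : ∀ x y, 0 ≤ w x y) (A B : Matrix ι ι ℂ) :
    schurNorm w (A + B) ≤ schurNorm w A + schurNorm w B := by
  refine schurNorm_le (add_nonneg (schurNorm_nonneg hw A) (schurNorm_nonneg hw B)) ?_ ?_
  · exact fun a => (weightedRowSum_add_le hw A B a).trans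
      (add_le_add (weightedRowSum_le_schurNorm w A a) (weightedRowSum_le_schurNorm w B a))
  · intro a
    rw [Matrix.conjTranspose_add]
    exact (weightedRowSum_add_le hw Aᴴ Bᴴ a).trans
      (add_le_add (weightedRowSum_conjTranspose_le_schurNorm w A a)
        (weightedRowSum_conjTranspose_le_schurNorm w B a))

theorem schurNorm_mul_le (hw : IsSubmultiplicativeWeight w) (A B : Matrix ι ι ℂ) :
    schurNorm w (A * B) ≤ schurNorm w A * schurNorm w B := by
  have hA := schurNorm_nonneg hw.nonneg A
  have hB := schurNorm_nonneg hw.nonneg B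
  refine schurNorm_le (mul_nonneg hA hB) (fun a => ?_) fun a => ?_
  · exact (weightedRowSum_mul_le hw (weightedRowSum_le_schurNorm w B) A a).trans
      (mul_le_mul_of_nonneg_right (weightedRowSum_le_schurNorm w A a) hB)
  · rw [Matrix.conjTranspose_mul, mul_comm (schurNorm w A)]
    exact (weightedRowSum_mul_le hw (weightedRowSum_conjTranspose_le_schurNorm w A) Bᴴ a).trans
      (mul_le_mul_of_nonneg_right (weightedRowSum_conjTranspose_le_schurNorm w B a) hA)

/-- `schurNorm w` as an algebra norm, to which the generic statements on Dyson series apply. -/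
noncomputable def schurAlgebraNorm [DecidableEq ι] (hw : IsSubmultiplicativeWeight w) :
    AlgebraNorm ℂ (Matrix ι ι ℂ) where
  toFun := schurNorm w
  map_zero' := by simpa using schurNorm_smul w 0 0
  add_le' := schurNorm_add_le hw.nonneg
  neg' A := by simpa using schurNorm_smul w (-1) A
  mul_le' := schurNorm_mul_le hw
  smul' := schurNorm_smul w
  eq_zero_of_map_eq_zero' A hA := by
    ext a b
    exact norm_le_zero_iff.1 ((norm_apply_le_schurNorm hw A a b).trans_eq hA)

theorem continuous_schurAlgebraNorm [DecidableEq ι] (hw : IsSubmultiplicativeWeight w) :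
    Continuous (schurAlgebraNorm hw) := by
  open scoped Matrix.Norms.Operator in
  exact ((schurAlgebraNorm hw).toSeminorm.convexOn.locallyLipschitz).continuous

theorem summable_of_schurNorm_le {α : Type*} (hw : IsSubmultiplicativeWeight w)
    {f : α → Matrix ι ι ℂ} {b : α → ℝ} (hb : Summable b) (h : ∀ k, schurNorm w (f k) ≤ b k) :
    Summable f :=
  Pi.summable.2 fun x => Pi.summable.2 fun y => hb.of_norm_bounded fun k =>
    (norm_apply_le_schurNorm hw (f k) x y).trans (h k)

theorem tendsto_zero_of_schurNorm_le {α : Type*} {u : Filter α} (hw : IsSubmultiplicativeWeight w)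
    {f : α → Matrix ι ι ℂ} {b : α → ℝ} (hb : Filter.Tendsto b u (nhds 0))
    (h : ∀ k, schurNorm w (f k) ≤ b k) : Filter.Tendsto f u (nhds 0) :=
  tendsto_pi_nhds.2 fun x => tendsto_pi_nhds.2 fun y => squeeze_zero_norm
    (fun k => (norm_apply_le_schurNorm hw (f k) x y).trans (h k)) hb

end SchurNorm

section KernelEstimate

theorem summable_exp_neg_mul_abs {d : ℝ} (hd : 0 < d) :
    Summable fun n : ℤ => Real.exp (-d * |(n : ℝ)|) := by
  have h_nat : Summable fun n : ℕ => Real.exp (-d * |((n : ℤ) : ℝ)|) := by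
    refine (summable_geometric_of_lt_one (Real.exp_pos (-d)).le
      (Real.exp_lt_one_iff.2 (neg_neg_of_pos hd))).congr fun n => ?_
    rw [← Real.exp_nat_mul, Int.cast_natCast, Nat.abs_cast, mul_comm]
  exact h_nat.of_nat_of_neg (by simpa using h_nat)

theorem exists_sum_exp_idxDist_le {d : ℝ} (hd : 0 < d) :
    ∃ G > 0, ∀ (N : ℕ) (x : Fin N), ∑ t, Real.exp (-d * idxDist x t) ≤ G := by
  have h_sum := summable_exp_neg_mul_abs hd
  refine ⟨∑' n : ℤ, Real.exp (-d * |(n : ℝ)|),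
    h_sum.tsum_pos (fun _ => (Real.exp_pos _).le) 0 (Real.exp_pos _), fun N x => ?_⟩
  let φ : Fin N ↪ ℤ := ⟨fun t => (x : ℤ) - (t : ℤ), fun s t h => Fin.ext (by simpa using h)⟩
  calc ∑ t, Real.exp (-d * idxDist x t)
      = ∑ n ∈ Finset.univ.map φ, Real.exp (-d * |(n : ℝ)|) := by
        rw [Finset.sum_map]
        refine Finset.sum_congr rfl fun t _ => ?_
        simp [idxDist, show φ t = (x : ℤ) - (t : ℤ) from rfl]
    _ ≤ ∑' n : ℤ, Real.exp (-d * |(n : ℝ)|) :=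
      h_sum.sum_le_tsum _ fun _ _ => (Real.exp_pos _).le

/-- The kernel which dominates `‖S_{xy,zt}‖` for an operator `S` of finite `l`-norm, summed over `y`
and `z`; its two parts come from the two terms in the definition of `ρ`. -/
def pairKernel {ι : Type*} [Fintype ι] (E : ι → ι → ℝ) (x t : ι) : ℝ :=
  ∑ y, ∑ z, (E x t * E y z + E x z * E y t)

theorem pairKernel_comm {ι : Type*} [Fintype ι] {E : ι → ι → ℝ} (hE : ∀ x y, E x y = E y x)
    (x t : ι) : pairKernel E x t = pairKernel E t x := by
  simp only [pairKernel, Finset.sum_add_distrib]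
  rw [hE x t]
  congr 1
  rw [Finset.sum_comm]
  simp only [hE _ t, hE x, mul_comm]

theorem sum_pairKernel_le {ι : Type*} [Fintype ι] {E : ι → ι → ℝ} {G : ℝ}
    (hE : ∀ x y, 0 ≤ E x y) (hG : ∀ x, ∑ y, E x y ≤ G) (x : ι) :
    ∑ t, pairKernel E x t ≤ 2 * G ^ 2 * Fintype.card ι := by
  have h_direct : ∑ t, ∑ y, ∑ z, E x t * E y z = (∑ t, E x t) * ∑ y, ∑ z, E y z := by
    rw [Finset.sum_mul]
    simp only [Finset.mul_sum]
  have h_exchange : ∑ t, ∑ y, ∑ z, E x z * E y t = (∑ z, E x z) * ∑ y, ∑ t, E y t := by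
    rw [Finset.sum_comm, Finset.mul_sum]
    simp only [← Finset.sum_mul, ← Finset.mul_sum]
  have h_le : (∑ t, E x t) * ∑ y, ∑ z, E y z ≤ G * (Fintype.card ι * G) := by
    have h_sum : ∑ y, ∑ z, E y z ≤ Fintype.card ι * G := by
      simpa using Finset.sum_le_sum fun y (_ : y ∈ Finset.univ) => hG y
    exact mul_le_mul (hG x) h_sum (Finset.sum_nonneg fun _ _ => Finset.sum_nonneg fun _ _ => hE _ _)
      ((Finset.sum_nonneg fun _ _ => hE _ _).trans (hG x))
  simp only [pairKernel, Finset.sum_add_distrib, h_direct, h_exchange]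
  linarith

variable {N : ℕ}

theorem idxDist_comm (x y : Fin N) : idxDist x y = idxDist y x := abs_sub_comm _ _

theorem idxDist_triangle (x y z : Fin N) : idxDist x z ≤ idxDist x y + idxDist y z :=
  abs_sub_le _ _ _

theorem idxDist_nonneg (x y : Fin N) : 0 ≤ idxDist x y := abs_nonneg _

theorem idxDist_self (x : Fin N) : idxDist x x = 0 := by simp [idxDist]

/-- The weight in `matLNorm`. -/
noncomputable def expWeight (l : ℝ) (x y : Fin N) : ℝ := Real.exp (idxDist x y / l)

variable {l l' : ℝ}

theorem expWeight_comm (l : ℝ) (x y : Fin N) : expWeight l x y = expWeight l y x := by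
  rw [expWeight, idxDist_comm, expWeight]

theorem isSubmultiplicativeWeight_expWeight (hl : 0 ≤ l) :
    IsSubmultiplicativeWeight (expWeight l : Fin N → Fin N → ℝ) where
  one_le x y := Real.one_le_exp (div_nonneg (idxDist_nonneg x y) hl)
  self x := by rw [expWeight, idxDist_self, zero_div, Real.exp_zero]
  le_mul x y z := by
    rw [expWeight, expWeight, expWeight, ← Real.exp_add, ← add_div, Real.exp_le_exp]
    gcongr
    exact idxDist_triangle x y z

theorem expWeight_mul_norm_le_matLNorm (l : ℝ) (A : Matrix (Fin N) (Fin N) ℂ) (x y : Fin N) :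
    expWeight l x y * ‖A x y‖ ≤ matLNorm l A :=
  le_ciSup (f := fun p : Fin N × Fin N => Real.exp (idxDist p.1 p.2 / l) * ‖A p.1 p.2‖)
    (Set.finite_range _).bddAbove (x, y)

theorem matLNorm_nonneg (l : ℝ) (A : Matrix (Fin N) (Fin N) ℂ) : 0 ≤ matLNorm l A :=
  Real.iSup_nonneg fun _ => by positivity

theorem matLNorm_le_schurNorm (l : ℝ) (A : Matrix (Fin N) (Fin N) ℂ) :
    matLNorm l A ≤ schurNorm (expWeight l) A :=
  have h_nonneg : ∀ x y : Fin N, 0 ≤ expWeight l x y := fun _ _ => (Real.exp_pos _).le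
  Real.iSup_le (fun p => mul_norm_le_schurNorm h_nonneg A p.1 p.2) (schurNorm_nonneg h_nonneg A)

/-- If `ρ(xy, zt)` equals `|x - t| + |y - z|`, the weights are attached to the same pairs as the
decay; otherwise `|x - t| ≤ |x - z| + |z - y| + |y - t|` moves the weight of `(x, t)` to the pairs
`(x, z)` and `(y, t)`, while the weight of `(y, z)` compensates for `|z - y|`. -/
theorem exp_mul_exp_rho_mul_exp_le (hl : 0 < l) (hl' : l < l') (x y z t : Fin N) :
    expWeight l' x t * Real.exp (-(rho x y z t / l)) * (expWeight l' y z)⁻¹ ≤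
      Real.exp (-(l⁻¹ - l'⁻¹) * idxDist x t) * Real.exp (-(l⁻¹ - l'⁻¹) * idxDist y z) +
      Real.exp (-(l⁻¹ - l'⁻¹) * idxDist x z) * Real.exp (-(l⁻¹ - l'⁻¹) * idxDist y t) := by
  simp only [expWeight, ← Real.exp_neg, ← Real.exp_add, div_eq_mul_inv]
  have h_inv : 0 < l'⁻¹ := inv_pos.2 (hl.trans hl')
  have h_triangle : idxDist x t ≤ idxDist x z + idxDist y z + idxDist y t := by
    rw [idxDist_comm y z]
    linarith [idxDist_triangle x z t, idxDist_triangle z y t]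
  have h_nonneg := idxDist_nonneg y z
  rcases min_choice (idxDist x t + idxDist y z) (idxDist x z + idxDist y t) with h_rho | h_rho
  · refine le_add_of_le_of_nonneg (Real.exp_le_exp.2 ?_) (Real.exp_pos _).le
    rw [rho, h_rho]
    nlinarith
  · refine le_add_of_nonneg_of_le (Real.exp_pos _).le (Real.exp_le_exp.2 ?_)
    rw [rho, h_rho]
    nlinarith

variable {S : Matrix (Fin N) (Fin N) ℂ →ₗ[ℂ] Matrix (Fin N) (Fin N) ℂ} {κ : ℝ}

theorem norm_coeff_le (hS : opLNorm l S ≤ κ) (x y z t : Fin N) :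
    ‖coeff S x y z t‖ ≤ κ * Real.exp (-(rho x y z t / l)) := by
  have h : Real.exp (rho x y z t / l) * ‖coeff S x y z t‖ ≤ opLNorm l S :=
    le_ciSup (f := fun p : Fin N × Fin N × Fin N × Fin N =>
      Real.exp (rho p.1 p.2.1 p.2.2.1 p.2.2.2 / l) * ‖coeff S p.1 p.2.1 p.2.2.1 p.2.2.2‖)
      (Set.finite_range _).bddAbove (x, y, z, t)
  rw [Real.exp_neg, ← div_eq_mul_inv, le_div_iff₀ (Real.exp_pos _), mul_comm]
  exact h.trans hS

theorem expWeight_mul_norm_apply_le (hl : 0 < l) (hl' : l < l') (hκ : 0 ≤ κ)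
    (hS : opLNorm l S ≤ κ) (A : Matrix (Fin N) (Fin N) ℂ) (x t : Fin N) :
    expWeight l' x t * ‖S A x t‖ ≤ κ * matLNorm l' A *
      pairKernel (fun u v => Real.exp (-(l⁻¹ - l'⁻¹) * idxDist u v)) x t := by
  have h_pos (u v : Fin N) : 0 < expWeight l' u v := Real.exp_pos _
  have h_nonneg := matLNorm_nonneg l' A
  have h_entry (y z : Fin N) : ‖A y z‖ ≤ matLNorm l' A * (expWeight l' y z)⁻¹ := by
    rw [← div_eq_mul_inv, le_div_iff₀' (h_pos y z)]
    exact expWeight_mul_norm_le_matLNorm l' A y z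
  rw [apply_eq_sum_coeff, pairKernel]
  calc expWeight l' x t * ‖∑ y, ∑ z, coeff S x y z t * A y z‖
      ≤ expWeight l' x t * ∑ y, ∑ z, ‖coeff S x y z t * A y z‖ :=
        mul_le_mul_of_nonneg_left
          ((norm_sum_le _ _).trans (Finset.sum_le_sum fun y _ => norm_sum_le _ _)) (h_pos x t).le
    _ = ∑ y, ∑ z, expWeight l' x t * (‖coeff S x y z t‖ * ‖A y z‖) := by
        simp only [Finset.mul_sum, norm_mul]
    _ ≤ ∑ y, ∑ z, expWeight l' x t * ((κ * Real.exp (-(rho x y z t / l))) *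
          (matLNorm l' A * (expWeight l' y z)⁻¹)) := by
        gcongr with y _ z _
        exacts [(h_pos x t).le, norm_coeff_le hS x y z t, h_entry y z]
    _ = ∑ y, ∑ z, κ * matLNorm l' A * (expWeight l' x t * Real.exp (-(rho x y z t / l)) *
          (expWeight l' y z)⁻¹) := by
        refine Finset.sum_congr rfl fun y _ => Finset.sum_congr rfl fun z _ => ?_
        ring
    _ ≤ _ := by
        simp only [Finset.mul_sum]
        gcongr with y _ z _
        exact exp_mul_exp_rho_mul_exp_le hl hl' x y z t

theorem schurNorm_apply_le {G : ℝ} (hl : 0 < l) (hl' : l < l')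
    (hG : ∀ x : Fin N, ∑ t, Real.exp (-(l⁻¹ - l'⁻¹) * idxDist x t) ≤ G) (hκ : 0 ≤ κ)
    (hS : opLNorm l S ≤ κ) (A : Matrix (Fin N) (Fin N) ℂ) :
    schurNorm (expWeight l') (S A) ≤ 2 * G ^ 2 * (N * κ) * schurNorm (expWeight l') A := by
  set E : Fin N → Fin N → ℝ := fun u v => Real.exp (-(l⁻¹ - l'⁻¹) * idxDist u v)
  have hE_comm (u v : Fin N) : E u v = E v u := by simp only [E, idxDist_comm]
  have h_nonneg := matLNorm_nonneg l' A
  have h_sum (x : Fin N) : ∑ t, κ * matLNorm l' A * pairKernel E x t ≤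
      2 * G ^ 2 * (N * κ) * matLNorm l' A := calc
    ∑ t, κ * matLNorm l' A * pairKernel E x t = κ * matLNorm l' A * ∑ t, pairKernel E x t :=
      (Finset.mul_sum _ _ _).symm
    _ ≤ κ * matLNorm l' A * (2 * G ^ 2 * Fintype.card (Fin N)) := by
      gcongr
      exact sum_pairKernel_le (fun _ _ => (Real.exp_pos _).le) hG x
    _ = 2 * G ^ 2 * (N * κ) * matLNorm l' A := by
      rw [Fintype.card_fin]
      ring
  have h_apply := expWeight_mul_norm_apply_le hl hl' hκ hS A
  refine le_trans (schurNorm_le (by positivity)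
    (fun x => (Finset.sum_le_sum fun t _ => h_apply x t).trans (h_sum x))
    fun x => (Finset.sum_le_sum fun t _ => ?_).trans (h_sum x)) ?_
  · rw [Matrix.conjTranspose_apply, norm_star, expWeight_comm, pairKernel_comm hE_comm]
    exact h_apply t x
  · gcongr
    exact matLNorm_le_schurNorm l' A

theorem exists_schurNorm_apply_le (hl : 0 < l) (hl' : l < l') :
    ∃ K > 0, ∀ (c : ℝ), 0 ≤ c → ∀ (N : ℕ)
      (S : Matrix (Fin N) (Fin N) ℂ →ₗ[ℂ] Matrix (Fin N) (Fin N) ℂ), opLNorm l S ≤ c / N →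
        ∀ A, schurNorm (expWeight l') (S A) ≤ K * c * schurNorm (expWeight l') A := by
  obtain ⟨G, hG, h_sum⟩ := exists_sum_exp_idxDist_le (sub_pos.2 (inv_strictAnti₀ hl hl'))
  refine ⟨2 * G ^ 2, by positivity, fun c hc N S hS A => ?_⟩
  have h_nonneg : 0 ≤ schurNorm (expWeight l') A :=
    schurNorm_nonneg (fun _ _ => (Real.exp_pos _).le) A
  have h_mul_div : N * (c / N) ≤ c := by
    rcases N.eq_zero_or_pos with rfl | hN
    · simpa using hc
    · exact (mul_div_cancel₀ c (by positivity)).le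
  refine (schurNorm_apply_le hl hl' (h_sum N) (by positivity) hS A).trans ?_
  gcongr

end KernelEstimate

section TreeSeries

variable {N : ℕ} {w : Fin N → Fin N → ℝ}
  {S : Matrix (Fin N) (Fin N) ℂ →ₗ[ℂ] Matrix (Fin N) (Fin N) ℂ} {κ R : ℝ} {z : ℂ}

theorem schurNorm_treeCoeff_le (hw : IsSubmultiplicativeWeight w) (hκ : 0 ≤ κ)
    (hS : ∀ A, schurNorm w (S A) ≤ κ * schurNorm w A) (k : ℕ) :
    schurNorm w (treeCoeff S k) ≤ (4 * κ) ^ k :=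
  (isDysonRecursion_treeCoeff S).map_le_four_mul_pow (p := schurAlgebraNorm hw)
    (schurNorm_one_le hw) hκ hS k

theorem schurNorm_seriesTerm_le (hw : IsSubmultiplicativeWeight w)
    (hC : ∀ k, schurNorm w (treeCoeff S k) ≤ R ^ k) (z : ℂ) (k : ℕ) :
    schurNorm w (seriesTerm S z k) ≤ ‖z‖⁻¹ * (R / ‖z‖ ^ 2) ^ k :=
  map_laurentTerm_le (schurAlgebraNorm hw) (hC k) z

theorem summable_seriesTerm (hw : IsSubmultiplicativeWeight w) (hR : 0 ≤ R)
    (hC : ∀ k, schurNorm w (treeCoeff S k) ≤ R ^ k) (hz : R < ‖z‖ ^ 2) :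
    Summable (seriesTerm S z) :=
  summable_of_schurNorm_le hw (hasSum_mul_div_sq_pow hR hz).summable
    (schurNorm_seriesTerm_le hw hC z)

theorem schurNorm_treeSeries_le (hw : IsSubmultiplicativeWeight w) (hR : 0 ≤ R)
    (hC : ∀ k, schurNorm w (treeCoeff S k) ≤ R ^ k) (hz : R < ‖z‖ ^ 2) :
    schurNorm w (treeSeries S z) ≤ ‖z‖⁻¹ * (1 - R / ‖z‖ ^ 2)⁻¹ :=
  map_le_of_hasSum (continuous_schurAlgebraNorm hw) (summable_seriesTerm hw hR hC hz).hasSum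
    (hasSum_mul_div_sq_pow hR hz) (schurNorm_seriesTerm_le hw hC z)

theorem solvesMDE_iff (S : Matrix (Fin N) (Fin N) ℂ →ₗ[ℂ] Matrix (Fin N) (Fin N) ℂ) (z : ℂ)
    (M : Matrix (Fin N) (Fin N) ℂ) : SolvesMDE S z M ↔ (z • 1 + S M) * M = -1 := by
  constructor
  · rintro ⟨hM, h⟩
    rw [← h, neg_mul, Matrix.nonsing_inv_mul M ((Matrix.isUnit_iff_isUnit_det M).1 hM)]
  · intro h
    have h_inv : -(z • 1 + S M) * M = 1 := by rw [neg_mul, h, neg_neg]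
    exact ⟨IsUnit.of_mul_eq_one_right _ h_inv, by rw [Matrix.inv_eq_left_inv h_inv, neg_neg]⟩

theorem solvesMDE_treeSeries (hw : IsSubmultiplicativeWeight w) (hR : 0 ≤ R)
    (hC : ∀ k, schurNorm w (treeCoeff S k) ≤ R ^ k) (hz : R < ‖z‖ ^ 2) :
    SolvesMDE S z (treeSeries S z) := by
  have hz_ne : z ≠ 0 := norm_ne_zero_iff.1 (pow_ne_zero_iff two_ne_zero |>.1 (hR.trans_lt hz).ne')
  open scoped Matrix.Norms.Operator in
  exact (solvesMDE_iff S z _).2 <| IsDysonRecursion.dyson_tsum_laurentTerm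
    (S := LinearMap.toContinuousLinearMap S) (isDysonRecursion_treeCoeff S) hz_ne
    (summable_norm_iff.2 (summable_seriesTerm hw hR hC hz))

theorem summable_matLNorm_seriesTerm {l : ℝ} (hl : 0 ≤ l) (hR : 0 ≤ R)
    (hC : ∀ k, schurNorm (expWeight l) (treeCoeff S k) ≤ R ^ k) (hz : R < ‖z‖ ^ 2) :
    Summable fun k => matLNorm l (seriesTerm S z k) :=
  (hasSum_mul_div_sq_pow hR hz).summable.of_nonneg_of_le (fun _ => matLNorm_nonneg l _) fun k =>
    (matLNorm_le_schurNorm l _).trans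
      (schurNorm_seriesTerm_le (isSubmultiplicativeWeight_expWeight hl) hC z k)

end TreeSeries

section PositiveImaginaryPart

open scoped Matrix.Norms.L2Operator MatrixOrder ComplexOrder ComplexStarModule Matrix

variable {N : ℕ} {S : Matrix (Fin N) (Fin N) ℂ →ₗ[ℂ] Matrix (Fin N) (Fin N) ℂ} {z : ℂ}
  {w : Fin N → Fin N → ℝ} {κ : ℝ}

theorem hasPosIm_iff_mem_upperHalfPlane {M : Matrix (Fin N) (Fin N) ℂ} :
    HasPosIm M ↔ M ∈ upperHalfPlane (Matrix (Fin N) (Fin N) ℂ) := by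
  rw [mem_upperHalfPlane_iff, Matrix.isStrictlyPositive_iff_posDef, HasPosIm,
    imaginaryPart_apply_coe, ← Matrix.star_eq_conjTranspose, ← Complex.coe_smul, smul_smul]
  norm_num [Complex.inv_I]

theorem PositivityPreserving.map_nonneg (hS : PositivityPreserving S)
    (X : Matrix (Fin N) (Fin N) ℂ) (hX : 0 ≤ X) : 0 ≤ S X :=
  (hS X (Matrix.nonneg_iff_posSemidef.1 hX)).nonneg

theorem PositivityPreserving.existsUnique_solvesMDE (hS : PositivityPreserving S)
    (hz : 0 < z.im) : ∃! M, SolvesMDE S z M ∧ HasPosIm M := by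
  simp only [solvesMDE_iff, hasPosIm_iff_mem_upperHalfPlane]
  exact existsUnique_dyson (.mk₀ S hS.map_nonneg) hz

theorem PositivityPreserving.hasPosIm_of_schurNorm_le {r : ℝ} (hw : IsSubmultiplicativeWeight w)
    (hS : PositivityPreserving S) (hκ : 0 ≤ κ)
    (hSκ : ∀ A, schurNorm w (S A) ≤ κ * schurNorm w A) (hz : 0 < z.im)
    {M : Matrix (Fin N) (Fin N) ℂ} (hM : SolvesMDE S z M) (hMr : schurNorm w M ≤ r)
    (hr : r ^ 2 * κ < 1) : HasPosIm M := by
  have hM_nonneg := schurNorm_nonneg hw.nonneg M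
  have hr_nonneg := hM_nonneg.trans hMr
  have h_contract (X : Matrix (Fin N) (Fin N) ℂ) :
      schurNorm w (Mᴴ * S X * M) ≤ r ^ 2 * κ * schurNorm w X := calc
    schurNorm w (Mᴴ * S X * M) ≤ schurNorm w (Mᴴ * S X) * schurNorm w M :=
      schurNorm_mul_le hw _ _
    _ ≤ schurNorm w M * schurNorm w (S X) * schurNorm w M := by
      gcongr
      exact (schurNorm_mul_le hw _ _).trans_eq (by rw [schurNorm_conjTranspose])
    _ ≤ r * (κ * schurNorm w X) * r := by
      have h := schurNorm_nonneg hw.nonneg X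
      gcongr
      exacts [schurNorm_nonneg hw.nonneg _, hSκ X]
    _ = r ^ 2 * κ * schurNorm w X := by ring
  have h_nonneg : 0 ≤ r ^ 2 * κ := by positivity
  refine hasPosIm_iff_mem_upperHalfPlane.2 <|
    mem_upperHalfPlane_of_tendsto_iterate (.mk₀ S hS.map_nonneg) hz ((solvesMDE_iff S z M).1 hM) ?_
  refine tendsto_zero_of_schurNorm_le hw ?_ fun n => map_iterate_le h_nonneg h_contract n _
  simpa using (tendsto_pow_atTop_nhds_zero_of_lt_one h_nonneg hr).mul_const _

theorem PositivityPreserving.hasPosIm_treeSeries (hw : IsSubmultiplicativeWeight w)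
    (hS : PositivityPreserving S) (hκ : 0 ≤ κ)
    (hSκ : ∀ A, schurNorm w (S A) ≤ κ * schurNorm w A) (hz : 0 < z.im)
    (h_norm : 16 * κ < ‖z‖ ^ 2) : HasPosIm (treeSeries S z) := by
  have hC := schurNorm_treeCoeff_le hw hκ hSκ
  have hR : 0 ≤ 4 * κ := by positivity
  have hR_lt : 4 * κ < ‖z‖ ^ 2 := by linarith
  refine hS.hasPosIm_of_schurNorm_le hw hκ hSκ hz
    (solvesMDE_treeSeries hw hR hC hR_lt) (schurNorm_treeSeries_le hw hR hC hR_lt) ?_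
  have h_ratio : 4 * κ / ‖z‖ ^ 2 < 1 / 4 := by
    rw [div_lt_div_iff₀ (by linarith) (by norm_num)]
    linarith
  calc (‖z‖⁻¹ * (1 - 4 * κ / ‖z‖ ^ 2)⁻¹) ^ 2 * κ
      = 4 * κ / ‖z‖ ^ 2 / 4 * ((1 - 4 * κ / ‖z‖ ^ 2)⁻¹) ^ 2 := by ring
    _ ≤ 1 / 4 / 4 * ((1 - 1 / 4)⁻¹) ^ 2 := by
      gcongr
      exact inv_nonneg.2 (by linarith)
    _ < 1 := by norm_num

theorem PositivityPreserving.solvesMDE_and_hasPosIm_iff (hS : PositivityPreserving S)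
    (hz : 0 < z.im) {M₀ : Matrix (Fin N) (Fin N) ℂ} (h_solves : SolvesMDE S z M₀)
    (h_pos : HasPosIm M₀) (M : Matrix (Fin N) (Fin N) ℂ) :
    SolvesMDE S z M ∧ HasPosIm M ↔ M = M₀ :=
  ⟨fun hM => (hS.existsUnique_solvesMDE hz).unique hM ⟨h_solves, h_pos⟩,
    fun h => h ▸ ⟨h_solves, h_pos⟩⟩

end PositiveImaginaryPart

end MDE

theorem mainTheorem1_general (l : ℝ) (hl : 0 < l) (ε : ℝ) (hε : 0 < ε) :
    ∃ K : ℝ, 0 < K ∧ ∀ (c : ℝ), 0 ≤ c → ∀ (N : ℕ)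
      (S : Matrix (Fin N) (Fin N) ℂ →ₗ[ℂ] Matrix (Fin N) (Fin N) ℂ), MDE.opLNorm l S ≤ c / N →
      (∀ k : ℕ, MDE.matLNorm ((1 + ε) * l) (MDE.treeCoeff S k) ≤ (K * c) ^ k) ∧
      (∀ z : ℂ, K * c < ‖z‖ ^ 2 →
        Summable (fun k => MDE.matLNorm ((1 + ε) * l) (MDE.seriesTerm S z k)) ∧
        Summable (fun k => MDE.seriesTerm S z k) ∧
        MDE.matLNorm ((1 + ε) * l) (MDE.treeSeries S z) ≤ ‖z‖⁻¹ * (1 - K * c / ‖z‖ ^ 2)⁻¹ ∧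
        MDE.SolvesMDE S z (MDE.treeSeries S z)) ∧
      (MDE.PositivityPreserving S →
        (∀ z : ℂ, 0 < z.im →
          ∃! M : Matrix (Fin N) (Fin N) ℂ, MDE.SolvesMDE S z M ∧ MDE.HasPosIm M) ∧
        (∀ z : ℂ, 0 < z.im → K * c < ‖z‖ ^ 2 → ∀ M : Matrix (Fin N) (Fin N) ℂ,
          (MDE.SolvesMDE S z M ∧ MDE.HasPosIm M) ↔ M = MDE.treeSeries S z)) := by
  have hl' : l < (1 + ε) * l := lt_mul_of_one_lt_left hl (lt_add_of_pos_right 1 hε)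
  obtain ⟨K, hK, h_apply⟩ := MDE.exists_schurNorm_apply_le hl hl'
  refine ⟨16 * K, by positivity, fun c hc N S h_op => ?_⟩
  have hw := MDE.isSubmultiplicativeWeight_expWeight (N := N) (hl.trans hl').le
  have hκ : 0 ≤ K * c := by positivity
  have hS := h_apply c hc N S h_op
  have hR : 0 ≤ 16 * K * c := by positivity
  have hC (k : ℕ) : MDE.schurNorm (MDE.expWeight ((1 + ε) * l)) (MDE.treeCoeff S k) ≤
      (16 * K * c) ^ k :=
    (MDE.schurNorm_treeCoeff_le hw hκ hS k).trans (pow_le_pow_left₀ (by positivity) (by linarith) k)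
  refine ⟨fun k => (MDE.matLNorm_le_schurNorm _ _).trans (hC k), fun z hz =>
    ⟨MDE.summable_matLNorm_seriesTerm (hl.trans hl').le hR hC hz,
      MDE.summable_seriesTerm hw hR hC hz,
      (MDE.matLNorm_le_schurNorm _ _).trans (MDE.schurNorm_treeSeries_le hw hR hC hz),
      MDE.solvesMDE_treeSeries hw hR hC hz⟩, fun h_pos =>
    ⟨fun z hz => h_pos.existsUnique_solvesMDE hz, fun z hz h_norm =>
      h_pos.solvesMDE_and_hasPosIm_iff hz (MDE.solvesMDE_treeSeries hw hR hC h_norm)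
        (h_pos.hasPosIm_treeSeries hw hκ hS hz (by rwa [← mul_assoc]))⟩⟩

theorem mainTheorem1 (l : ℝ) (hl : 0 < l) (ε : ℝ) (hε : 0 < ε) :
    ∃ K : ℝ, 0 < K ∧ ∀ (c : ℝ), 0 ≤ c → ∀ (N : ℕ)
      (S : Matrix (Fin N) (Fin N) ℂ →ₗ[ℂ] Matrix (Fin N) (Fin N) ℂ),
      MDE.PositivityPreserving S → MDE.opLNorm l S ≤ c / N →
      (∀ k : ℕ, MDE.matLNorm ((1 + ε) * l) (MDE.treeCoeff S k) ≤ (K * c) ^ k) ∧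
      (∀ z : ℂ, K * c < ‖z‖ ^ 2 →
        Summable (fun k => MDE.matLNorm ((1 + ε) * l) (MDE.seriesTerm S z k)) ∧
        Summable (fun k => MDE.seriesTerm S z k) ∧
        MDE.matLNorm ((1 + ε) * l) (MDE.treeSeries S z)
          ≤ ‖z‖⁻¹ * (1 - K * c / ‖z‖ ^ 2)⁻¹ ∧
        MDE.SolvesMDE S z (MDE.treeSeries S z)) ∧
      (∀ z : ℂ, 0 < z.im →
        ∃! M : Matrix (Fin N) (Fin N) ℂ, MDE.SolvesMDE S z M ∧ MDE.HasPosIm M) ∧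
      (∀ z : ℂ, 0 < z.im → K * c < ‖z‖ ^ 2 → ∀ M : Matrix (Fin N) (Fin N) ℂ,
        (MDE.SolvesMDE S z M ∧ MDE.HasPosIm M) ↔ M = MDE.treeSeries S z) := by
  obtain ⟨K, hK, h⟩ := mainTheorem1_general l hl ε hε
  exact ⟨K, hK, fun c hc N S h_pos h_op =>
    ⟨(h c hc N S h_op).1, (h c hc N S h_op).2.1, (h c hc N S h_op).2.2 h_pos⟩⟩
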